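/- **Setting.** A two-way transducer $\mathcal T$ has a finite state set $Q$, an initial state $q_0$, a set $F\subseteq Q$ of final states, and a finite set of rules $(q,a,v,q',d)$ with $q,q'\in Q$, $a$ an input letter or a delimiter $\vdash,\dashv$, $v$ an output word, and $d\in\{\mathsf{left},\mathsf{right}\}$; there are no left rules on $\vdash$. A successful run on $u=a_1\cdots a_\omega={\vdash}\,w\,{\dashv}$ starts in state $q_0$ with the head on $a_1$ and ends in a final state when the head moves right from $a_\omega$. $\mathcal T$ is functional if all successful runs on the same input have the same output. Let $\rho$ be a successful run. Positions $0,\dots,\omega$ are the cuts between consecutive letters ($x$ lies between $a_x$ and $a_{x+1}$). The initial configuration is at position $0$; a right transition reading $a_x$ leads to position $x$, and a left transition reading $a_{x+1}$ leads to position $x$. The configuration that is the $(y+1)$-th one at position $x$ is the location $(x,y)$, of level $y$. The crossing sequence $\rho|x$ is the sequence of states at $(x,0),(x,1),\dots$. Locations are ordered by $\unlhd$ (strictly: $\lhd$) as they occur in $\rho$. The run is normalized if no two distinct locations have the same position, the same state and levels of the same parity. For a set $Z$ of locations, $\rho\mid Z$ is the sequence of transitions of $\rho$ whose source and target locations are both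 in $Z$, and $\mathrm{out}(\rho\mid Z)$ is the concatenation of their outputs. Intervals of positions are $[x_1,x_2]$ with $0\le x_1<x_2\le\omega$. A factor intercepted by $[x_1,x_2]$ is a maximal non-empty factor of $\rho$ whose transitions all read letters among $a_{x_1+1},\dots,a_{x_2}$. The flow $F_I$ of $I=[x_1,x_2]$ is the graph with nodes $0,\dots,\max(|\rho|x_1|,|\rho|x_2|)-1$ and an edge $(y,y')$ for every intercepted factor from a location of level $y$ to a location of level $y'$, both at position $x_1$ or $x_2$. The effect is $E_I=(F_I,\rho|x_1,\rho|x_2)$. In general, an effect is a triple $(F,c_1,c_2)$ of a graph and two sequences of states of lengths $h_1,h_2\le h_{\max}$ such that each node has at most one incoming and one outgoing edge, an even $y$ has an outgoing edge iff $y<h_1$ and an incoming edge iff $y<h_2$, and an odd $y$ has an incoming edge iff $y<h_1$ and an outgoing edge iff $y<h_2$. Let $F_{LR},F_{RL},F_{LL},F_{RR}$ be the sets of edges even$\to$even, odd$\to$odd, even$\to$odd, odd$\to$even. With relational composition $\cdot$ and reflexive-transitive closure $^*$, the product $F\circ F'$ is the graph with $LR$-part $F_{LR}(F'_{LL}F_{RR})^*F'_{LR}$,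 $RL$-part $F'_{RL}(F_{RR}F'_{LL})^*F_{RL}$, $LL$-part $F_{LL}\cup F_{LR}(F'_{LL}F_{RR})^*F'_{LL}F_{RL}$ and $RR$-part $F'_{RR}\cup F'_{RL}(F_{RR}F'_{LL})^*F_{RR}F'_{LR}$; and $(F,c_1,c_2)\odot(F',c_1',c_2')$ is $(F\circ F',c_1,c_2')$ if $c_2=c_1'$ and this is an effect, and $\bot$ otherwise. A loop is an interval $L=[x_1,x_2]$ with $\rho|x_1=\rho|x_2$; it is idempotent if $E_L\odot E_L=E_L\ (\neq\bot)$. A component $C$ of $L$ is a strongly connected component of $F_L$. Its anchor $\mathrm{an}(C)$ is $(x_1,\max C)$ if $\min C$ is even and $(x_2,\max C)$ if $\min C$ is odd. Its trace $\mathrm{tr}(C)$ (for $L$ idempotent, in which case $C$ is a cycle) is the concatenation of the intercepted factors corresponding to the edges of the cycle $C$, in cycle order starting from $\max C$. Let $c_{\max}$ be the maximal length of the output of a rule, $h_{\max}=2|Q|-1$, $e_{\max}=(2|Q|)^{2h_{\max}}$ and $\boldsymbol B=c_{\max}\cdot h_{\max}\cdot(2^{3e_{\max}}+4)$. **Theorem.**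 Let $\rho$ be a normalized successful run of a functional two-way transducer $\mathcal T$. Let $I=[x_1,x_2]$ be an interval of positions, $K=[\ell_1,\ell_2]$ an interval of locations ($\ell_1\unlhd\ell_2$), and $Z=K\cap(I\times\mathbb N)$. If $|\mathrm{out}(\rho\mid Z)|>\boldsymbol B$, then there exist an idempotent loop $L$ of $\rho$ and a component $C$ of $L$ such that * $x_1<\min(L)<\max(L)<x_2$, * $\ell_1\lhd\mathrm{an}(C)\lhd\ell_2$, * $\mathrm{out}(\mathrm{tr}(C))\neq\varepsilon$. -/

import Mathlib

/-- The two directions in which the head can move. -/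
inductive Dir where
  | left
  | right

/-- Tape symbols: the left delimiter `⊢`, the right delimiter `⊣`, and the input letters. -/
inductive Letter (α : Type*) where
  | lend
  | rend
  | sym (a : α)

/-- A transition rule `(q, a, w, q', d)`. -/
structure Rule (Q α β : Type*) where
  src : Q
  letter : Letter α
  out : List β
  tgt : Q
  dir : Dir

/-- Two-way transducers with states `Q`, input alphabet `α`, output alphabet `β`. The set of rules
is finite, and no rule moves left on the left delimiter. -/
structure TwoWayTransducer (Q α β : Type*) where
  rules : Finset (Rule Q α β)
  start : Q
  final : Set Q
  no_left : ∀ t ∈ rules, t.letter = Letter.lend → t.dir = Dir.right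

/-- The delimited input `⊢ w ⊣`. -/
def tape {α : Type*} (w : List α) : List (Letter α) :=
  Letter.lend :: (w.map Letter.sym ++ [Letter.rend])

/-- On a fixed delimited input, the configuration `u q v` is given by `head = |u|` and
`state = q`; the head reads the first symbol of `v`, i.e. entry `head` of the tape, counting
from `0`. -/
structure Config (Q : Type*) where
  head : ℕ
  state : Q

namespace TwoWayTransducer

variable {Q α β : Type*} (T : TwoWayTransducer Q α β)

/-- `c → c'` on input `w` by means of the rule `t`. -/
def Step (w : List α) (c : Config Q) (t : Rule Q α β) (c' : Config Q) : Prop :=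
  t ∈ T.rules ∧ t.src = c.state ∧ t.tgt = c'.state ∧ (tape w)[c.head]? = some t.letter ∧
    match t.dir with
    | Dir.right => c'.head = c.head + 1
    | Dir.left => c.head = c'.head + 1

/-- The capacity `c_max`: the maximal length of the output of a transition. -/
def cmax : ℕ := T.rules.sup fun t => t.out.length

end TwoWayTransducer

/-- `h_max = 2|Q| - 1`. -/
def hmax (Q : Type*) [Fintype Q] : ℕ := 2 * Fintype.card Q - 1

/-- `e_max = (2|Q|)^(2 h_max)`. -/
def emax (Q : Type*) [Fintype Q] : ℕ := (2 * Fintype.card Q) ^ (2 * hmax Q)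

/-- `B = c_max · h_max · (2^(3 e_max) + 4)`. -/
def TwoWayTransducer.bound {Q α β : Type*} [Fintype Q] (T : TwoWayTransducer Q α β) : ℕ :=
  T.cmax * hmax Q * (2 ^ (3 * emax Q) + 4)

/-- A run on `⊢ w ⊣` with `len` transitions: transition number `i < len` leads from configuration
`conf i` to configuration `conf (i + 1)` by the rule `rule i`. Values of `conf` beyond `len`, and
of `rule` from `len` on, have no meaning. -/
structure Run {Q α β : Type*} (T : TwoWayTransducer Q α β) (w : List α) where
  len : ℕ
  conf : ℕ → Config Q
  rule : ℕ → Rule Q α β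
  step : ∀ i < len, T.Step w (conf i) (rule i) (conf (i + 1))

/-- The output of a sequence of transitions. -/
def outputOf {Q α β : Type*} (τ : List (Rule Q α β)) : List β := τ.flatMap fun t => t.out

/-- An effect candidate: the edge relation of a flow, and the crossing sequences at the left and
right border. The nodes of the flow are the numbers below the maximum of the two lengths. -/
structure Effect (Q : Type*) where
  flow : ℕ → ℕ → Prop
  left : List Q
  right : List Q

namespace Effect

/-- The effects proper: crossing sequences of length at most `h_max`, and the in-degree and
out-degree conditions on flows. These confine all edges to the nodes of the flow. -/
structure IsValid {Q : Type*} [Fintype Q] (E : Effect Q) : Prop where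
  left_le : E.left.length ≤ hmax Q
  right_le : E.right.length ≤ hmax Q
  out_unique : ∀ y z z', E.flow y z → E.flow y z' → z = z'
  in_unique : ∀ y y' z, E.flow y z → E.flow y' z → y = y'
  even_out : ∀ y, Even y → ((∃ z, E.flow y z) ↔ y < E.left.length)
  odd_in : ∀ y, Odd y → ((∃ z, E.flow z y) ↔ y < E.left.length)
  even_in : ∀ y, Even y → ((∃ z, E.flow z y) ↔ y < E.right.length)
  odd_out : ∀ y, Odd y → ((∃ z, E.flow y z) ↔ y < E.right.length)

end Effect

/-- Edges between even nodes. -/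
def flowLR (F : ℕ → ℕ → Prop) (y z : ℕ) : Prop := F y z ∧ Even y ∧ Even z

/-- Edges between odd nodes. -/
def flowRL (F : ℕ → ℕ → Prop) (y z : ℕ) : Prop := F y z ∧ Odd y ∧ Odd z

/-- Edges from an even node to an odd node. -/
def flowLL (F : ℕ → ℕ → Prop) (y z : ℕ) : Prop := F y z ∧ Even y ∧ Odd z

/-- Edges from an odd node to an even node. -/
def flowRR (F : ℕ → ℕ → Prop) (y z : ℕ) : Prop := F y z ∧ Odd y ∧ Even z

/-- The graph whose `LR`, `RL`, `LL`, `RR` parts are those prescribed for the product `F ∘ F'`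
(each of the four disjuncts only has edges of the respective parity type). -/
def flowComp (F F' : ℕ → ℕ → Prop) (y z : ℕ) : Prop :=
  Relation.Comp (flowLR F)
    (Relation.Comp (Relation.ReflTransGen (Relation.Comp (flowLL F') (flowRR F)))
      (flowLR F')) y z ∨
  Relation.Comp (flowRL F')
    (Relation.Comp (Relation.ReflTransGen (Relation.Comp (flowRR F) (flowLL F')))
      (flowRL F)) y z ∨
  (flowLL F y z ∨
    Relation.Comp (flowLR F)
      (Relation.Comp (Relation.ReflTransGen (Relation.Comp (flowLL F') (flowRR F)))
        (Relation.Comp (flowLL F') (flowRL F))) y z) ∨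
  (flowRR F' y z ∨
    Relation.Comp (flowRL F')
      (Relation.Comp (Relation.ReflTransGen (Relation.Comp (flowRR F) (flowLL F')))
        (Relation.Comp (flowRR F) (flowLR F'))) y z)

open Classical in
/-- The product `E ⊙ E'`, where `none` is the dummy element `⊥`. -/
noncomputable def Effect.mul {Q : Type*} [Fintype Q] (E E' : Effect Q) : Option (Effect Q) :=
  if E.right = E'.left ∧ Effect.IsValid ⟨flowComp E.flow E'.flow, E.left, E'.right⟩ then
    some ⟨flowComp E.flow E'.flow, E.left, E'.right⟩
  else none

namespace Run

variable {Q α β : Type*} {T : TwoWayTransducer Q α β} {w : List α} (ρ : Run T w)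

/-- The transitions of `ρ` numbered `i, ..., j - 1`. -/
def factor (i j : ℕ) : List (Rule Q α β) := (List.Ico i j).map ρ.rule

/-- The output of the whole run. -/
def output : List β := outputOf (ρ.factor 0 ρ.len)

/-- The run leads from the initial configuration `q₀ w` to a configuration `w q` with `q` final. -/
def Successful : Prop :=
  ρ.conf 0 = ⟨0, T.start⟩ ∧
    ∃ q ∈ T.final, ρ.conf ρ.len = ⟨(tape w).length, q⟩

/-- The position (cut between tape cells) of the `i`-th location of the run. The run starts at
position `0`. A right transition from head position `h` (which reads the symbol number `h + 1`,
counting from `1`, and moves to head position `h + 1`) crosses the cut `h + 1`; a left transition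
from head position `h` crosses the cut `h`. -/
def pos : ℕ → ℕ
  | 0 => (ρ.conf 0).head
  | i + 1 =>
    match (ρ.rule i).dir with
    | Dir.right => (ρ.conf i).head + 1
    | Dir.left => (ρ.conf i).head

/-- The level of the `i`-th location: the number of earlier visits to the same position. -/
def level (i : ℕ) : ℕ := ((Finset.range i).filter fun j => ρ.pos j = ρ.pos i).card

/-- The `i`-th location visited by the run, for `i ≤ len`. -/
def loc (i : ℕ) : ℕ × ℕ := (ρ.pos i, ρ.level i)

/-- The crossing sequence at position `x`: the states at the locations `(x, 0), (x, 1), ...`. -/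
def crossing (x : ℕ) : List Q :=
  ((List.range (ρ.len + 1)).filter fun i => ρ.pos i = x).map fun i => (ρ.conf i).state

/-- The run never visits two locations with the same position, state and parity of the level. -/
def Normalized : Prop :=
  ∀ i ≤ ρ.len, ∀ j ≤ ρ.len, ρ.pos i = ρ.pos j → (ρ.conf i).state = (ρ.conf j).state →
    (Even (ρ.level i) ↔ Even (ρ.level j)) → i = j

/-- The run order `⊴` on locations. -/
def Le (l l' : ℕ × ℕ) : Prop :=
  ∃ i j, i ≤ j ∧ j ≤ ρ.len ∧ ρ.loc i = l ∧ ρ.loc j = l'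

/-- The strict run order `⊲` on locations. -/
def Lt (l l' : ℕ × ℕ) : Prop :=
  ∃ i j, i < j ∧ j ≤ ρ.len ∧ ρ.loc i = l ∧ ρ.loc j = l'

/-- The interval of locations `[l₁, l₂]`. -/
def locInterval (l₁ l₂ : ℕ × ℕ) : Set (ℕ × ℕ) := {l | ρ.Le l₁ l ∧ ρ.Le l l₂}

open Classical in
/-- The restriction `ρ ∣ Z`: the sequence of those transitions of `ρ` whose source and target
locations both lie in `Z`. -/
noncomputable def restrict (Z : Set (ℕ × ℕ)) : List (Rule Q α β) :=
  ((List.range ρ.len).filter fun i => ρ.loc i ∈ Z ∧ ρ.loc (i + 1) ∈ Z).map ρ.rule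

/-- Transition number `i` takes place inside the interval of positions `[x₁, x₂]`: the symbol that
it reads lies between the cuts `x₁` and `x₂`. -/
def Inside (x₁ x₂ i : ℕ) : Prop := x₁ ≤ (ρ.conf i).head ∧ (ρ.conf i).head < x₂

/-- The factor between the `i`-th and the `j`-th location is intercepted by `[x₁, x₂]`: it is a
maximal (non-empty) factor all of whose transitions take place inside `[x₁, x₂]`. -/
def Intercepted (x₁ x₂ i j : ℕ) : Prop :=
  i < j ∧ j ≤ ρ.len ∧ (∀ k, i ≤ k → k < j → ρ.Inside x₁ x₂ k) ∧
    (0 < i → ¬ ρ.Inside x₁ x₂ (i - 1)) ∧ (j < ρ.len → ¬ ρ.Inside x₁ x₂ j)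

/-- The factor between the `i`-th and the `j`-th location is intercepted by `[x₁, x₂]` and
corresponds to the edge `(y, z)` of the flow. -/
def EdgeFactor (x₁ x₂ y z i j : ℕ) : Prop :=
  ρ.Intercepted x₁ x₂ i j ∧
    (ρ.loc i = (x₁, y) ∨ ρ.loc i = (x₂, y)) ∧ (ρ.loc j = (x₁, z) ∨ ρ.loc j = (x₂, z))

/-- The edges of the flow of `[x₁, x₂]`. -/
def flow (x₁ x₂ y z : ℕ) : Prop := ∃ i j, ρ.EdgeFactor x₁ x₂ y z i j

/-- The effect of `[x₁, x₂]`. -/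
def effect (x₁ x₂ : ℕ) : Effect Q := ⟨ρ.flow x₁ x₂, ρ.crossing x₁, ρ.crossing x₂⟩

/-- `[x₁, x₂]` is an interval of positions. -/
def IsInterval (_ρ : Run T w) (x₁ x₂ : ℕ) : Prop := x₁ < x₂ ∧ x₂ ≤ (tape w).length

/-- `[x₁, x₂]` is a loop. -/
def IsLoop (x₁ x₂ : ℕ) : Prop := ρ.IsInterval x₁ x₂ ∧ ρ.crossing x₁ = ρ.crossing x₂

/-- `[x₁, x₂]` is an idempotent loop. -/
def IsIdempotentLoop [Fintype Q] (x₁ x₂ : ℕ) : Prop :=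
  ρ.IsLoop x₁ x₂ ∧ (ρ.effect x₁ x₂).mul (ρ.effect x₁ x₂) = some (ρ.effect x₁ x₂)

/-- `C` is the node set of a strongly connected component of the flow of `[x₁, x₂]`. -/
def IsComponent (x₁ x₂ : ℕ) (C : Set ℕ) : Prop :=
  ∃ y < max (ρ.crossing x₁).length (ρ.crossing x₂).length,
    C = {z | Relation.ReflTransGen (ρ.flow x₁ x₂) y z ∧ Relation.ReflTransGen (ρ.flow x₁ x₂) z y}

/-- `τ` is the trace of the component `C` inside the loop `[x₁, x₂]`: `node 0, ..., node (k + 1)`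
runs once through the cycle `C`, starting and ending at the maximum of `C`, and `τ` is the
concatenation of the intercepted factors that correspond to the edges of this cycle. -/
def IsTrace (x₁ x₂ : ℕ) (C : Set ℕ) (τ : List (Rule Q α β)) : Prop :=
  ∃ (k : ℕ) (node src tgt : ℕ → ℕ),
    node 0 = sSup C ∧ node (k + 1) = sSup C ∧
    Set.BijOn node (Set.Iic k) C ∧
    (∀ j ≤ k, ρ.EdgeFactor x₁ x₂ (node j) (node (j + 1)) (src j) (tgt j)) ∧
    τ = (List.range (k + 1)).flatMap fun j => ρ.factor (src j) (tgt j)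

end Run

open Classical in
/-- The anchor of the component `C` inside the loop `[x₁, x₂]`: the component is left-to-right if
its minimum is even, and right-to-left otherwise. -/
noncomputable def anchor (x₁ x₂ : ℕ) (C : Set ℕ) : ℕ × ℕ :=
  if Even (sInf C) then (x₁, sSup C) else (x₂, sSup C)

/-- For each input, all successful runs have the same output. -/
def TwoWayTransducer.Functional {Q α β : Type*} (T : TwoWayTransducer Q α β) : Prop :=
  ∀ (w : List α) (ρ ρ' : Run T w), ρ.Successful → ρ'.Successful → ρ.output = ρ'.output

/-! In a normalized run a cell is read at most 2|Q| times, so long output inside `Z` comes from many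
cells. The proof picks, among cuts at productive cells, eight cuts with equal crossing sequences
such that all intervals between them have the same flow (`exists_uniform_positions`).

Such cuts exist because a flow carries little information. A turning edge climbs exactly one level,
and traversing factors match the levels at the two borders monotonically, so the flow is determined
by the lengths of the two crossing sequences and the two sets of traversing levels (`flow_eq`).
These sets shrink as the interval grows. A chain argument (`exists_subset_constant`) makes their
size constant; then each set depends on one endpoint only, up to a fixed outer position, and the
pigeonhole principle applies to single positions.

Equal flows F on [a,b], [b,d] and [a,d] force idempotency. Take a traversing edge u → v of F. The
corresponding factor of [a,d] first meets b at level v and last meets it at level u. Any two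
consecutive visits to b in between bound a turn in one of the halves, so F contains v → v+1 → … → u
(`flow_traverse`). Every traversing edge thus closes a cycle, and such flows satisfy F ∘ F = F
(`flowComp_self`). The anchor of the cycle is the start of the traversing factor, and its trace
contains that factor (`exists_trace`).

For a < b < c < d among the cuts, a productive transition inside [b,c] lies on a traversing factor
of [a,d] (`traversing_of_middle`), so the trace has non-empty output. The anchor comes before ℓ₂
since it does not come after the productive transition. If it does not come after ℓ₁, the head is
inside [a,d] at ℓ₁; this cannot happen for two disjoint loops, which is why eight cuts are used. -/

/-! ### Positions, levels and crossing sequences -/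

namespace Run

variable {Q α β : Type*} {T : TwoWayTransducer Q α β} {w : List α} (ρ : Run T w)

/-- The head position of the `i`-th configuration. -/
def hd (i : ℕ) : ℕ := (ρ.conf i).head

theorem step_cases {i : ℕ} (hi : i < ρ.len) :
    (ρ.pos (i + 1) = ρ.hd i + 1 ∧ ρ.hd (i + 1) = ρ.hd i + 1) ∨
      (ρ.pos (i + 1) = ρ.hd i ∧ ρ.hd i = ρ.hd (i + 1) + 1) := by
  have h := (ρ.step i hi).2.2.2.2
  rcases hd : (ρ.rule i).dir with _ | _
  · right
    simp only [hd] at h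
    simp [pos, hd, Run.hd, h]
  · left
    simp only [hd] at h
    simp [pos, hd, Run.hd, h]

variable {ρ}

theorem Successful.hd_zero (hρ : ρ.Successful) : ρ.hd 0 = 0 := by simp [hd, hρ.1]

theorem Successful.pos_zero (hρ : ρ.Successful) : ρ.pos 0 = 0 := by simp [pos, hρ.1]

theorem Successful.hd_len (hρ : ρ.Successful) : ρ.hd ρ.len = (tape w).length := by
  obtain ⟨q, _, h⟩ := hρ.2
  simp [hd, h]

variable (ρ)

/-- The number of visits to position `x` before time `n`. -/
def visits (x n : ℕ) : ℕ := ((Finset.range n).filter fun j => ρ.pos j = x).card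

theorem level_eq_visits (i : ℕ) : ρ.level i = ρ.visits (ρ.pos i) i := rfl

theorem visits_succ (x n : ℕ) :
    ρ.visits x (n + 1) = ρ.visits x n + if ρ.pos n = x then 1 else 0 := by
  unfold visits
  rw [Finset.range_add_one, Finset.filter_insert]
  split_ifs
  · rw [Finset.card_insert_of_notMem (by simp)]
  · simp

theorem visits_mono (x : ℕ) : Monotone (ρ.visits x) :=
  monotone_nat_of_le_succ fun n => by rw [visits_succ]; omega

theorem crossing_length (x : ℕ) : (ρ.crossing x).length = ρ.visits x (ρ.len + 1) := by
  unfold crossing visits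
  rw [List.length_map]
  rfl

variable {ρ}

/-- Each visit to a cut brings the head to its other side. The initial location counts as a visit to
cut 0, and the head is then to the right of that cut. -/
theorem Successful.odd_visits (hρ : ρ.Successful) (x : ℕ) {i : ℕ} (hi : i ≤ ρ.len) :
    Odd (ρ.visits x (i + 1)) ↔ x ≤ ρ.hd i := by
  induction i with
  | zero =>
    rw [visits_succ, hρ.pos_zero, hρ.hd_zero]
    have : ρ.visits x 0 = 0 := by simp [visits]
    rw [this]
    by_cases h : 0 = x
    · subst h; simp
    · simp [h]; omega
  | succ i ih =>
    have ih := ih (by omega)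
    rw [visits_succ]
    have hs := ρ.step_cases (i := i) (by omega)
    split_ifs with h
    · rw [Nat.odd_add_one, ih]; omega
    · rw [add_zero, ih]; omega

theorem Successful.even_level (hρ : ρ.Successful) {i : ℕ} (hi : i ≤ ρ.len) :
    Even (ρ.level i) ↔ ρ.pos i ≤ ρ.hd i := by
  rw [← hρ.odd_visits _ hi, visits_succ, if_pos rfl, Nat.odd_add_one, Nat.not_odd_iff_even]
  rfl

theorem Successful.pos_eq (hρ : ρ.Successful) {i : ℕ} (hi : i ≤ ρ.len) :
    ρ.pos i = ρ.hd i ∨ ρ.pos i = ρ.hd i + 1 := by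
  cases i with
  | zero => left; rw [hρ.hd_zero, hρ.pos_zero]
  | succ i => have := ρ.step_cases (i := i) (by omega); omega

theorem Successful.odd_crossing (hρ : ρ.Successful) {x : ℕ} (hx : x ≤ (tape w).length) :
    Odd (ρ.crossing x).length := by
  rw [crossing_length, hρ.odd_visits x le_rfl, hρ.hd_len]; exact hx

variable (ρ)

theorem level_lt_level {i j : ℕ} (hij : i < j) (h : ρ.pos i = ρ.pos j) :
    ρ.level i < ρ.level j := by
  have := ρ.visits_mono (ρ.pos j) (show i + 1 ≤ j from hij)
  rw [visits_succ, if_pos h] at this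
  rw [level_eq_visits, level_eq_visits, h]; omega

theorem loc_injective {i j : ℕ} (h : ρ.pos i = ρ.pos j) (h' : ρ.level i = ρ.level j) : i = j := by
  rcases lt_trichotomy i j with hl | hl | hl
  · have := ρ.level_lt_level hl h; omega
  · exact hl
  · have := ρ.level_lt_level hl h.symm; omega

theorem loc_injective' : Function.Injective ρ.loc := fun i j h => by
  simp only [loc, Prod.mk.injEq] at h
  exact ρ.loc_injective h.1 h.2

theorem level_next {i j : ℕ} (hij : i < j) (h : ρ.pos i = ρ.pos j)
    (hb : ∀ k, i < k → k < j → ρ.pos k ≠ ρ.pos j) : ρ.level j = ρ.level i + 1 := by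
  rw [level_eq_visits, level_eq_visits, h]
  obtain ⟨n, rfl⟩ := Nat.exists_eq_add_of_lt hij
  clear hij
  have : ∀ m ≤ n, ρ.visits (ρ.pos (i + n + 1)) (i + m + 1) = ρ.visits (ρ.pos (i + n + 1)) i + 1 := by
    intro m
    induction m with
    | zero => intro _; rw [add_zero, visits_succ, if_pos h]
    | succ m ih =>
      intro hm
      rw [visits_succ, ← add_assoc, ih (by omega), if_neg (hb _ (by omega) (by omega))]
  exact this n le_rfl

theorem exists_visit (x : ℕ) {n y : ℕ} (hy : y < ρ.visits x n) :
    ∃ i < n, ρ.pos i = x ∧ ρ.level i = y := by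
  induction n with
  | zero => simp [visits] at hy
  | succ n ih =>
    rw [visits_succ] at hy
    by_cases h : y < ρ.visits x n
    · obtain ⟨i, hi, h⟩ := ih h
      exact ⟨i, by omega, h⟩
    · split_ifs at hy with hx
      · exact ⟨n, by omega, hx, by rw [level_eq_visits, hx]; omega⟩
      · omega

theorem exists_loc {x y : ℕ} (hy : y < (ρ.crossing x).length) :
    ∃ i ≤ ρ.len, ρ.pos i = x ∧ ρ.level i = y := by
  rw [crossing_length] at hy
  obtain ⟨i, hi, h⟩ := ρ.exists_visit x hy
  exact ⟨i, by omega, h⟩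

theorem level_lt_crossing {i : ℕ} (hi : i ≤ ρ.len) :
    ρ.level i < (ρ.crossing (ρ.pos i)).length := by
  have := ρ.visits_mono (ρ.pos i) (show i + 1 ≤ ρ.len + 1 by omega)
  rw [visits_succ, if_pos rfl] at this
  rw [crossing_length, level_eq_visits]; omega

theorem inside_iff {x₁ x₂ i : ℕ} : ρ.Inside x₁ x₂ i ↔ x₁ ≤ ρ.hd i ∧ ρ.hd i < x₂ := Iff.rfl

variable {ρ}

/-- State and level parity distinguish the visits to x, which gives 2|Q|; the number of visits is
odd, which saves one. -/
theorem Normalized.crossing_le [Fintype Q] (hn : ρ.Normalized) (hρ : ρ.Successful) {x : ℕ}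
    (hx : x ≤ (tape w).length) : (ρ.crossing x).length ≤ hmax Q := by
  classical
  have hodd := hρ.odd_crossing hx
  have : (ρ.crossing x).length ≤ 2 * Fintype.card Q := by
    rw [crossing_length, visits, mul_comm, ← Fintype.card_bool, ← Fintype.card_prod]
    refine Finset.card_le_card_of_injOn
      (fun i => ((ρ.conf i).state, decide (Even (ρ.level i)))) (by simp) ?_
    intro i hi j hj h
    simp only [Finset.coe_filter, Finset.mem_range, Set.mem_ofPred_eq] at hi hj
    simp only [Prod.mk.injEq, decide_eq_decide] at h
    exact hn i (by omega) j (by omega) (by rw [hi.2, hj.2]) h.1 h.2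
  unfold hmax
  rcases hodd with ⟨k, hk⟩
  omega

/-- A configuration reading cell c sits at cut c or c + 1, and the parity of its level tells which.
State and parity therefore fix the location. -/
theorem Normalized.card_reading_le [Fintype Q] (hn : ρ.Normalized) (hρ : ρ.Successful) (c : ℕ) :
    ((Finset.range ρ.len).filter fun i => ρ.hd i = c).card ≤ 2 * Fintype.card Q := by
  classical
  rw [mul_comm, ← Fintype.card_bool, ← Fintype.card_prod]
  refine Finset.card_le_card_of_injOn
    (fun i => ((ρ.conf i).state, decide (ρ.pos i ≤ ρ.hd i))) (by simp) ?_
  intro i hi j hj h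
  simp only [Finset.coe_filter, Finset.mem_range, Set.mem_ofPred_eq] at hi hj
  simp only [Prod.mk.injEq, decide_eq_decide] at h
  have h1 := hρ.pos_eq (i := i) (by omega)
  have h2 := hρ.pos_eq (i := j) (by omega)
  refine hn i (by omega) j (by omega) (by omega) h.1 ?_
  rw [hρ.even_level (by omega), hρ.even_level (by omega)]
  exact h.2

end Run

/-! ### Intercepted factors and the flow of an interval -/

namespace Run

variable {Q α β : Type*} {T : TwoWayTransducer Q α β} {w : List α}

/-- An interval of positions of a successful run that does not contain the position `0`. -/
structure Inner (ρ : Run T w) (x y : ℕ) : Prop where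
  succ : ρ.Successful
  pos_left : 0 < x
  lt : x < y
  le : y ≤ (tape w).length

variable {ρ : Run T w} {x y : ℕ}

/-- The run starts at cell 0, outside the interval since `0 < x`, so a factor starts just after a
border has been crossed inwards. -/
theorem Inner.start (h : ρ.Inner x y) {i j : ℕ} (hij : ρ.Intercepted x y i j) :
    0 < i ∧ ((ρ.pos i = x ∧ ρ.hd i = x ∧ ρ.hd (i - 1) + 1 = x ∧ Even (ρ.level i)) ∨
      (ρ.pos i = y ∧ ρ.hd i + 1 = y ∧ ρ.hd (i - 1) = y ∧ Odd (ρ.level i))) := by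
  obtain ⟨h1, h2, h3, h4, h5⟩ := hij
  have hi := h3 i le_rfl h1
  rw [inside_iff] at hi
  have hp := h.pos_left
  have hi0 : 0 < i := by
    rcases Nat.eq_zero_or_pos i with rfl | h'
    · have := h.succ.hd_zero; omega
    · exact h'
  have h4 := h4 hi0
  rw [inside_iff] at h4
  have hs := ρ.step_cases (i := i - 1) (by omega)
  rw [Nat.sub_add_cancel hi0] at hs
  rw [← Nat.not_even_iff_odd, h.succ.even_level (by omega)]
  omega

theorem Inner.finish (h : ρ.Inner x y) {i j : ℕ} (hij : ρ.Intercepted x y i j) :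
    (ρ.pos j = x ∧ ρ.hd j + 1 = x ∧ ρ.hd (j - 1) = x ∧ Odd (ρ.level j)) ∨
      (ρ.pos j = y ∧ ρ.hd j = y ∧ ρ.hd (j - 1) + 1 = y ∧ Even (ρ.level j)) := by
  obtain ⟨h1, h2, h3, h4, h5⟩ := hij
  have hi := h3 (j - 1) (by omega) (by omega)
  rw [inside_iff] at hi
  have hj : ¬ (x ≤ ρ.hd j ∧ ρ.hd j < y) := by
    rcases h2.eq_or_lt with rfl | h'
    · have := h.succ.hd_len; have := h.le; omega
    · exact h5 h'
  have hs := ρ.step_cases (i := j - 1) (by omega)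
  rw [Nat.sub_add_cancel (by omega)] at hs
  rw [← Nat.not_even_iff_odd, h.succ.even_level (by omega)]
  omega

theorem Inner.flow_iff (h : ρ.Inner x y) {u v : ℕ} :
    ρ.flow x y u v ↔ ∃ i j, ρ.Intercepted x y i j ∧ ρ.level i = u ∧ ρ.level j = v := by
  constructor
  · rintro ⟨i, j, hij, hi, hj⟩
    refine ⟨i, j, hij, ?_, ?_⟩
    · rcases hi with hi | hi <;> exact congrArg Prod.snd hi
    · rcases hj with hj | hj <;> exact congrArg Prod.snd hj
  · rintro ⟨i, j, hij, rfl, rfl⟩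
    refine ⟨i, j, hij, ?_, ?_⟩
    · rcases h.start hij with ⟨_, hi | hi⟩ <;> simp [loc, hi.1]
    · rcases h.finish hij with hi | hi <;> simp [loc, hi.1]

theorem Intercepted.le_of_mem {i j i' j' t : ℕ} (h : ρ.Intercepted x y i j)
    (h' : ∀ k, i' ≤ k → k < j' → ρ.Inside x y k) (hj' : j' ≤ ρ.len) (ht : i ≤ t) (ht' : t < j)
    (hs : i' ≤ t) (hs' : t < j') : i ≤ i' ∧ j' ≤ j := by
  obtain ⟨h1, h2, h3, h4, h5⟩ := h
  constructor
  · by_contra hc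
    exact h4 (by omega) (h' _ (by omega) (by omega))
  · by_contra hc
    exact h5 (by omega) (h' _ (by omega) (by omega))

theorem Intercepted.unique {i j i' j' t : ℕ} (h : ρ.Intercepted x y i j)
    (h' : ρ.Intercepted x y i' j') (ht : i ≤ t) (ht' : t < j) (hs : i' ≤ t) (hs' : t < j') :
    i = i' ∧ j = j' := by
  have h1 := h.le_of_mem h'.2.2.1 h'.2.1 ht ht' hs hs'
  have h2 := h'.le_of_mem h.2.2.1 h.2.1 hs hs' ht ht'
  omega

theorem Inner.exists_intercepted (h : ρ.Inner x y) {t : ℕ} (ht : t < ρ.len)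
    (hin : ρ.Inside x y t) : ∃ i j, ρ.Intercepted x y i j ∧ i ≤ t ∧ t < j := by
  classical
  have hlast : ¬ ρ.Inside x y ρ.len := by
    rw [inside_iff, h.succ.hd_len]; have := h.le; omega
  have hex : ∃ n, t < n ∧ ¬ ρ.Inside x y n := ⟨ρ.len, ht, hlast⟩
  have hex' : ∃ n ≤ t, ∀ k, n ≤ k → k ≤ t → ρ.Inside x y k :=
    ⟨t, le_rfl, fun k h1 h2 => by rwa [le_antisymm h2 h1]⟩
  obtain ⟨hj1, hj2⟩ := Nat.find_spec hex
  obtain ⟨hi1, hi2⟩ := Nat.find_spec hex'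
  refine ⟨Nat.find hex', Nat.find hex, ⟨by omega, Nat.find_min' hex ⟨ht, hlast⟩, ?_, ?_,
    fun _ => hj2⟩, hi1, hj1⟩
  · intro k h1 h2
    by_cases hk : k ≤ t
    · exact hi2 k h1 hk
    · by_contra hc
      exact Nat.find_min hex h2 ⟨by omega, hc⟩
  · intro h0 hc
    refine Nat.find_min hex' (m := Nat.find hex' - 1) (by omega) ⟨by omega, ?_⟩
    intro k h1 h2
    rcases h1.eq_or_lt with rfl | h1
    · exact hc
    · exact hi2 k (by omega) h2

theorem Inner.exists_start (h : ρ.Inner x y) {i : ℕ} (hi : i ≤ ρ.len)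
    (hs : (ρ.pos i = x ∧ Even (ρ.level i)) ∨ (ρ.pos i = y ∧ Odd (ρ.level i))) :
    ∃ j, ρ.Intercepted x y i j := by
  have hx := h.pos_left
  have hxy := h.lt
  have hi0 : 0 < i := by
    rcases Nat.eq_zero_or_pos i with rfl | h'
    · have := h.succ.pos_zero; omega
    · exact h'
  have hc := ρ.step_cases (i := i - 1) (by omega)
  rw [Nat.sub_add_cancel hi0] at hc
  rw [← Nat.not_even_iff_odd, h.succ.even_level hi] at hs
  have hlen : i ≠ ρ.len := by
    rintro rfl
    have := h.succ.hd_len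
    have := h.le
    omega
  obtain ⟨i', j, hij, h1, h2⟩ := h.exists_intercepted (t := i) (by omega)
    (by rw [inside_iff]; omega)
  have : i' = i := by
    by_contra hne
    have := hij.2.2.1 (i - 1) (by omega) (by omega)
    rw [inside_iff] at this
    omega
  exact ⟨j, this ▸ hij⟩

theorem Inner.exists_finish (h : ρ.Inner x y) {j : ℕ} (hj : j ≤ ρ.len)
    (hs : (ρ.pos j = x ∧ Odd (ρ.level j)) ∨ (ρ.pos j = y ∧ Even (ρ.level j))) :
    ∃ i, ρ.Intercepted x y i j := by
  have hx := h.pos_left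
  have hxy := h.lt
  have hj0 : 0 < j := by
    rcases Nat.eq_zero_or_pos j with rfl | h'
    · have := h.succ.pos_zero; omega
    · exact h'
  have hc := ρ.step_cases (i := j - 1) (by omega)
  rw [Nat.sub_add_cancel hj0] at hc
  rw [← Nat.not_even_iff_odd, h.succ.even_level hj] at hs
  obtain ⟨i, j', hij, h1, h2⟩ := h.exists_intercepted (t := j - 1) (by omega)
    (by rw [inside_iff]; omega)
  have : j' = j := by
    by_contra hne
    have := hij.2.2.1 j (by omega) (by omega)
    rw [inside_iff] at this
    omega
  exact ⟨i, this ▸ hij⟩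

theorem Inner.start_unique (h : ρ.Inner x y) {i j i' j' : ℕ} (hij : ρ.Intercepted x y i j)
    (hij' : ρ.Intercepted x y i' j') (hl : ρ.level i = ρ.level i') : i = i' ∧ j = j' := by
  have hii : i = i' := by
    refine ρ.loc_injective ?_ hl
    have h1 := h.start hij
    have h2 := h.start hij'
    rw [hl] at h1
    simp only [← Nat.not_even_iff_odd] at h1 h2
    grind
  subst hii
  exact hij.unique hij' le_rfl hij.1 le_rfl hij'.1

theorem Inner.finish_unique (h : ρ.Inner x y) {i j i' j' : ℕ} (hij : ρ.Intercepted x y i j)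
    (hij' : ρ.Intercepted x y i' j') (hl : ρ.level j = ρ.level j') : i = i' ∧ j = j' := by
  have hjj : j = j' := by
    refine ρ.loc_injective ?_ hl
    have h1 := h.finish hij
    have h2 := h.finish hij'
    rw [hl] at h1
    simp only [← Nat.not_even_iff_odd] at h1 h2
    grind
  subst hjj
  have h1 := hij.1
  have h2 := hij'.1
  exact hij.unique hij' (t := j - 1) (by omega) (by omega) (by omega) (by omega)

/-- At a given border the parity of the level decides whether the run enters or leaves the interval
there. Every entering location starts a factor and every leaving one ends a factor. -/
theorem Inner.isValid [Fintype Q] (h : ρ.Inner x y) (hn : ρ.Normalized) :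
    (ρ.effect x y).IsValid where
  left_le := hn.crossing_le h.succ (h.lt.le.trans h.le)
  right_le := hn.crossing_le h.succ h.le
  out_unique := by
    intro u v v' h1 h2
    simp only [effect, h.flow_iff] at h1 h2
    obtain ⟨i, j, hij, rfl, rfl⟩ := h1
    obtain ⟨i', j', hij', hl, rfl⟩ := h2
    rw [(h.start_unique hij hij' hl.symm).2]
  in_unique := by
    intro u u' v h1 h2
    simp only [effect, h.flow_iff] at h1 h2
    obtain ⟨i, j, hij, rfl, rfl⟩ := h1
    obtain ⟨i', j', hij', rfl, hl⟩ := h2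
    rw [(h.finish_unique hij hij' hl.symm).1]
  even_out := by
    intro u hu
    simp only [effect, h.flow_iff]
    constructor
    · rintro ⟨v, i, j, hij, rfl, rfl⟩
      have hs := h.start hij
      rw [← Nat.not_even_iff_odd] at hs
      have hp : ρ.pos i = x := by tauto
      rw [← hp]
      exact ρ.level_lt_crossing (hij.1.le.trans hij.2.1)
    · intro hlt
      obtain ⟨i, hi, hp, rfl⟩ := ρ.exists_loc hlt
      obtain ⟨j, hij⟩ := h.exists_start hi (Or.inl ⟨hp, hu⟩)
      exact ⟨_, i, j, hij, rfl, rfl⟩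
  odd_out := by
    intro u hu
    simp only [effect, h.flow_iff]
    constructor
    · rintro ⟨v, i, j, hij, rfl, rfl⟩
      have hs := h.start hij
      rw [← Nat.not_odd_iff_even] at hs
      have hp : ρ.pos i = y := by tauto
      rw [← hp]
      exact ρ.level_lt_crossing (hij.1.le.trans hij.2.1)
    · intro hlt
      obtain ⟨i, hi, hp, rfl⟩ := ρ.exists_loc hlt
      obtain ⟨j, hij⟩ := h.exists_start hi (Or.inr ⟨hp, hu⟩)
      exact ⟨_, i, j, hij, rfl, rfl⟩
  even_in := by
    intro u hu
    simp only [effect, h.flow_iff]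
    constructor
    · rintro ⟨v, i, j, hij, rfl, rfl⟩
      have hs := h.finish hij
      rw [← Nat.not_even_iff_odd] at hs
      have hp : ρ.pos j = y := by tauto
      rw [← hp]
      exact ρ.level_lt_crossing hij.2.1
    · intro hlt
      obtain ⟨j, hj, hp, rfl⟩ := ρ.exists_loc hlt
      obtain ⟨i, hij⟩ := h.exists_finish hj (Or.inr ⟨hp, hu⟩)
      exact ⟨_, i, j, hij, rfl, rfl⟩
  odd_in := by
    intro u hu
    simp only [effect, h.flow_iff]
    constructor
    · rintro ⟨v, i, j, hij, rfl, rfl⟩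
      have hs := h.finish hij
      rw [← Nat.not_odd_iff_even] at hs
      have hp : ρ.pos j = x := by tauto
      rw [← hp]
      exact ρ.level_lt_crossing hij.2.1
    · intro hlt
      obtain ⟨j, hj, hp, rfl⟩ := ρ.exists_loc hlt
      obtain ⟨i, hij⟩ := h.exists_finish hj (Or.inl ⟨hp, hu⟩)
      exact ⟨_, i, j, hij, rfl, rfl⟩

/-- A turning edge of the flow leads to the next level. -/
theorem Inner.flow_turn (h : ρ.Inner x y) {u v : ℕ} (huv : ρ.flow x y u v)
    (hp : ¬(Even u ↔ Even v)) : v = u + 1 := by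
  rw [h.flow_iff] at huv
  obtain ⟨i, j, hij, rfl, rfl⟩ := huv
  have hs := h.start hij
  have hf := h.finish hij
  simp only [← Nat.not_even_iff_odd] at hs hf
  have hlt := h.lt
  have hpos : ρ.pos i = ρ.pos j := by grind
  refine ρ.level_next hij.1 hpos ?_
  -- Strictly between its ends the factor stays off both borders.
  intro k h1 h2
  have hj := hij.2.1
  have hk := hij.2.2.1 k h1.le h2
  have hk' := hij.2.2.1 (k - 1) (by omega) (by omega)
  rw [inside_iff] at hk hk'
  have hc := ρ.step_cases (i := k - 1) (by omega)
  rw [Nat.sub_add_cancel (by omega)] at hc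
  have : ρ.pos j = x ∨ ρ.pos j = y := by tauto
  omega

/-- Two consecutive visits to an inner position contribute an edge to one of the two flows. -/
theorem Inner.flow_of_consecutive {z k k' : ℕ} (h : ρ.Inner x y) (h' : ρ.Inner y z) (hk : k < k')
    (hk' : k' ≤ ρ.len) (hpk : ρ.pos k = y) (hpk' : ρ.pos k' = y)
    (hb : ∀ t, k < t → t < k' → ρ.pos t ≠ y)
    (hin : ∀ t, k ≤ t → t < k' → ρ.Inside x z t) :
    ρ.flow x y (ρ.level k) (ρ.level k + 1) ∨ ρ.flow y z (ρ.level k) (ρ.level k + 1) := by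
  have hl : ρ.level k' = ρ.level k + 1 :=
    ρ.level_next hk (hpk.trans hpk'.symm) (by rwa [hpk'])
  rw [h.flow_iff, h'.flow_iff, ← hl]
  have hx := h.pos_left
  have hxy := h.lt
  have hyz := h'.lt
  have hk0 : 0 < k := by
    rcases Nat.eq_zero_or_pos k with rfl | h'
    · have := h.succ.pos_zero; omega
    · exact h'
  have hck := ρ.step_cases (i := k - 1) (by omega)
  rw [Nat.sub_add_cancel hk0] at hck
  have hck' := ρ.step_cases (i := k' - 1) (by omega)
  rw [Nat.sub_add_cancel (by omega)] at hck'
  -- Without visiting y the head cannot change its side of y.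
  have hconst : ∀ n, k + n < k' → (y ≤ ρ.hd (k + n) ↔ y ≤ ρ.hd k) := by
    intro n
    induction n with
    | zero => simp
    | succ n ih =>
      intro hn
      have ih := ih (by omega)
      have h1 := hb (k + n + 1) (by omega) (by omega)
      have hc := ρ.step_cases (i := k + n) (by omega)
      rw [← ih, ← add_assoc]
      omega
  have hconst' : ∀ t, k ≤ t → t < k' → (y ≤ ρ.hd t ↔ y ≤ ρ.hd k) := by
    intro t h1 h2
    have := hconst (t - k) (by omega)
    rwa [Nat.add_sub_cancel' h1] at this
  have hlast := hconst' (k' - 1) (by omega) (by omega)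
  simp only [inside_iff] at hin
  by_cases hy : y ≤ ρ.hd k
  · right
    refine ⟨k, k', ⟨hk, hk', ?_, ?_, ?_⟩, rfl, rfl⟩
    · intro t h1 h2
      have := hin t h1 h2
      have := hconst' t h1 h2
      rw [inside_iff]; omega
    · intro _; rw [inside_iff]; omega
    · intro _; rw [inside_iff]; omega
  · left
    refine ⟨k, k', ⟨hk, hk', ?_, ?_, ?_⟩, rfl, rfl⟩
    · intro t h1 h2
      have := hin t h1 h2
      have := hconst' t h1 h2
      rw [inside_iff]; omega
    · intro _; rw [inside_iff]; omega
    · intro _; rw [inside_iff]; omega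

end Run

/-! ### Adjacent intervals with the same flow as their union -/

namespace Run

variable {Q α β : Type*} {T : TwoWayTransducer Q α β} {w : List α} {ρ : Run T w}

/-- The visits to b at levels y and y + 1 both fall between p and q, so the run stays inside [a, d]
from one to the other. -/
theorem Inner.flow_succ_of_between {a b d i j p q y : ℕ} (hab : ρ.Inner a b) (hbd : ρ.Inner b d)
    (hij : ρ.Intercepted a d i j) (hip : i ≤ p) (hqj : q < j)
    (hp : ρ.pos p = b) (hq : ρ.pos q = b) (hpy : ρ.level p ≤ y) (hyq : y < ρ.level q) :
    ρ.flow a b y (y + 1) ∨ ρ.flow b d y (y + 1) := by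
  have hlen := hij.2.1
  have hlt := ρ.level_lt_crossing (i := q) (by omega)
  rw [hq] at hlt
  obtain ⟨k, hk, hpk, rfl⟩ := ρ.exists_loc (x := b) (y := y) (by omega)
  obtain ⟨k', hk', hpk', hlk'⟩ := ρ.exists_loc (x := b) (y := ρ.level k + 1) (by omega)
  have hmono : ∀ s t, ρ.pos s = b → ρ.pos t = b → ρ.level s < ρ.level t → s < t := by
    intro s t hs ht hst
    by_contra hc
    rcases (not_lt.1 hc).eq_or_lt with rfl | hc
    · omega
    · have := ρ.level_lt_level hc (by rw [hs, ht]); omega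
  have hkk' := hmono k k' hpk hpk' (by omega)
  have hpk0 : p ≤ k := by
    by_contra hc
    have := ρ.level_lt_level (not_le.1 hc) (by rw [hp, hpk]); omega
  have hqk0 : k' ≤ q := by
    by_contra hc
    have := ρ.level_lt_level (not_le.1 hc) (by rw [hq, hpk']); omega
  refine hab.flow_of_consecutive hbd hkk' hk' hpk hpk' ?_ ?_
  · intro t h1 h2 hpt
    have := ρ.level_lt_level h1 (by rw [hpt, hpk])
    have := ρ.level_lt_level h2 (by rw [hpt, hpk'])
    omega
  · intro t h1 h2
    exact hij.2.2.1 t (by omega) (by omega)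

/-- If two consecutive intervals and their union have the same flow, then the source of a
traversing edge is reached from its target by climbing the levels. -/
theorem Inner.flow_traverse {a b d u v : ℕ} (hab : ρ.Inner a b) (hbd : ρ.Inner b d)
    (had : ρ.Inner a d) (h1 : ρ.flow a b = ρ.flow a d) (h2 : ρ.flow b d = ρ.flow a d)
    (huv : ρ.flow a d u v) (hp : Even u ↔ Even v) :
    v ≤ u ∧ ∀ y, v ≤ y → y < u → ρ.flow a d y (y + 1) := by
  have huv1 := huv
  have huv2 := huv
  rw [← h1, hab.flow_iff] at huv1
  rw [← h2, hbd.flow_iff] at huv2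
  rw [had.flow_iff] at huv
  obtain ⟨i, j, hij, hi, hj⟩ := huv
  obtain ⟨i1, j1, hij1, hi1, hj1⟩ := huv1
  obtain ⟨i2, j2, hij2, hi2, hj2⟩ := huv2
  -- By equality of flows, the piece of the factor before its first visit p to b and the piece after
  -- its last visit q to b also realize u → v in their halves. Hence p has level v and q has level
  -- u.
  have key : ∃ p q, ρ.pos p = b ∧ ρ.pos q = b ∧ ρ.level p = v ∧ ρ.level q = u ∧ i ≤ p ∧ p ≤ q ∧
      q < j := by
    have s := had.start hij
    have s1 := hab.start hij1
    have s2 := hbd.start hij2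
    have f := had.finish hij
    have f1 := hab.finish hij1
    have f2 := hbd.finish hij2
    simp only [← Nat.not_even_iff_odd, hi, hj, hi1, hj1, hi2, hj2] at s s1 s2 f f1 f2
    have l1 := hij.1
    have l2 := hij1.1
    have l3 := hij2.1
    have g1 : ∀ k, i1 ≤ k → k < j1 → ρ.Inside a d k := fun k h1 h2 => by
      have := hij1.2.2.1 k h1 h2; have := hbd.lt; rw [inside_iff] at *; omega
    have g2 : ∀ k, i2 ≤ k → k < j2 → ρ.Inside a d k := fun k h1 h2 => by
      have := hij2.2.2.1 k h1 h2; have := hab.lt; rw [inside_iff] at *; omega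
    by_cases hu : Even u
    · have hv := hp.1 hu
      have e1 : i1 = i := ρ.loc_injective (by grind) (by omega)
      have e2 : j2 = j := ρ.loc_injective (by grind) (by omega)
      subst e1 e2
      refine ⟨j1, i2, by grind, by grind, hj1, hi2, by omega, ?_, by omega⟩
      have := (hij.le_of_mem (t := j2 - 1) g2 hij2.2.1 (by omega) (by omega) (by omega)
        (by omega)).1
      by_contra hc
      have c1 := hij1.2.2.1 i2 this (by omega)
      have c2 := hij2.2.2.1 i2 le_rfl l3
      rw [inside_iff] at c1 c2; omega
    · have hv := fun h => hu (hp.2 h)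
      have e1 : i2 = i := ρ.loc_injective (by grind) (by omega)
      have e2 : j1 = j := ρ.loc_injective (by grind) (by omega)
      subst e1 e2
      refine ⟨j2, i1, by grind, by grind, hj2, hi1, by omega, ?_, by omega⟩
      have := (hij.le_of_mem (t := j1 - 1) g1 hij1.2.1 (by omega) (by omega) (by omega)
        (by omega)).1
      by_contra hc
      have c1 := hij2.2.2.1 i1 this (by omega)
      have c2 := hij1.2.2.1 i1 le_rfl l2
      rw [inside_iff] at c1 c2; omega
  obtain ⟨p, q, hpp, hqq, hpv, hqu, hip, hpq, hqj⟩ := key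
  constructor
  · rcases hpq.eq_or_lt with rfl | hpq
    · omega
    · have := ρ.level_lt_level hpq (by rw [hpp, hqq]); omega
  · intro y hy hy'
    have := hab.flow_succ_of_between hbd hij hip hqj hpp hqq (by omega) (y := y) (by omega)
    rwa [h1, h2, or_self] at this

end Run

/-! ### Cyclic flows are idempotent -/

/-- Flows that consist of cycles `m → m + 1 → ... → M → m`, with a single traversing edge each. -/
structure CyclicFlow (F : ℕ → ℕ → Prop) : Prop where
  out_unique : ∀ y z z', F y z → F y z' → z = z'
  turn : ∀ u v, F u v → ¬(Even u ↔ Even v) → v = u + 1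
  traverse : ∀ u v, F u v → (Even u ↔ Even v) → v ≤ u ∧ ∀ y, v ≤ y → y < u → F y (y + 1)

/-- Two successive climbing edges form one zigzag step of the product. -/
theorem reflTransGen_of_climb {F : ℕ → ℕ → Prop} {m : ℕ} (n : ℕ) (hF : ∀ y, m ≤ y → y < m + 2 * n → F y (y + 1)) :
    (Even m → Relation.ReflTransGen (Relation.Comp (flowLL F) (flowRR F)) m (m + 2 * n)) ∧
    (Odd m → Relation.ReflTransGen (Relation.Comp (flowRR F) (flowLL F)) m (m + 2 * n)) := by
  induction n with
  | zero => exact ⟨fun _ => .refl, fun _ => .refl⟩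
  | succ n ih =>
    have ih := ih fun y h1 h2 => hF y h1 (by omega)
    have e1 := hF (m + 2 * n) (by omega) (by omega)
    have e2 := hF (m + 2 * n + 1) (by omega) (by omega)
    constructor <;> intro hm
    · exact (ih.1 hm).tail ⟨m + 2 * n + 1, ⟨e1, by grind, by grind⟩, ⟨e2, by grind, by grind⟩⟩
    · exact (ih.2 hm).tail ⟨m + 2 * n + 1, ⟨e1, by grind, by grind⟩, ⟨e2, by grind, by grind⟩⟩

namespace CyclicFlow

variable {F : ℕ → ℕ → Prop}

/-- A zigzag step climbs two levels, and it cannot start at M, whose only outgoing edge is the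
traversing one. -/
theorem even_of_reach (h : CyclicFlow F) {M m u : ℕ} (hMm : F M m) (hM : Even M) (hm : Even m)
    (hu : Relation.ReflTransGen (Relation.Comp (flowLL F) (flowRR F)) m u) :
    m ≤ u ∧ u ≤ M ∧ Even u := by
  have ht := h.traverse M m hMm (by simp [hM, hm])
  induction hu with
  | refl => exact ⟨le_rfl, ht.1, hm⟩
  | @tail b c _ hbc ih =>
    obtain ⟨p, ⟨h1, _, hp⟩, ⟨h2, _, hc⟩⟩ := hbc
    have e1 := h.turn _ _ h1 (by grind)
    have e2 := h.turn _ _ h2 (by grind)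
    have : b ≠ M := by
      rintro rfl
      have := h.out_unique _ _ _ h1 hMm
      subst this
      grind
    refine ⟨by omega, ?_, hc⟩
    grind

theorem odd_of_reach (h : CyclicFlow F) {M m u : ℕ} (hMm : F M m) (hM : Odd M) (hm : Odd m)
    (hu : Relation.ReflTransGen (Relation.Comp (flowRR F) (flowLL F)) m u) :
    m ≤ u ∧ u ≤ M ∧ Odd u := by
  have ht := h.traverse M m hMm (by grind)
  induction hu with
  | refl => exact ⟨le_rfl, ht.1, hm⟩
  | @tail b c _ hbc ih =>
    obtain ⟨p, ⟨h1, _, hp⟩, ⟨h2, _, hc⟩⟩ := hbc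
    have e1 := h.turn _ _ h1 (by grind)
    have e2 := h.turn _ _ h2 (by grind)
    have : b ≠ M := by
      rintro rfl
      have := h.out_unique _ _ _ h1 hMm
      subst this
      grind
    refine ⟨by omega, ?_, hc⟩
    grind

/-- After a traversing edge M → m the product can only zigzag up from m. All nodes below M turn, so
the next traversing edge is met exactly at M and is M → m again; for the same reason the composite
turning paths do not exist. -/
theorem flowComp_self (h : CyclicFlow F) : flowComp F F = F := by
  ext y z
  constructor
  · rintro (⟨m, ⟨h1, hy, hm⟩, u, hu, h2, hu', hz⟩ | ⟨m, ⟨h1, hy, hm⟩, u, hu, h2, hu', hz⟩ |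
      (h1 | ⟨m, ⟨h1, hy, hm⟩, u, hu, p, ⟨h2, hu', hp⟩, h3, _, hz⟩) |
      (h1 | ⟨m, ⟨h1, hy, hm⟩, u, hu, p, ⟨h2, hu', hp⟩, h3, _, hz⟩))
    · have hr := h.even_of_reach h1 hy hm hu
      have ht := h.traverse _ _ h1 (by grind)
      rcases hr.2.1.eq_or_lt with rfl | hlt
      · rwa [h.out_unique _ _ _ h2 h1]
      · have := h.out_unique _ _ _ h2 (ht.2 u hr.1 hlt)
        grind
    · have hr := h.odd_of_reach h1 hy hm hu
      have ht := h.traverse _ _ h1 (by grind)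
      rcases hr.2.1.eq_or_lt with rfl | hlt
      · rwa [h.out_unique _ _ _ h2 h1]
      · have := h.out_unique _ _ _ h2 (ht.2 u hr.1 hlt)
        grind
    · exact h1.1
    · have hr := h.even_of_reach h1 hy hm hu
      have ht := h.traverse _ _ h1 (by grind)
      have hpu := h.turn _ _ h2 (by grind)
      rcases hr.2.1.eq_or_lt with rfl | hlt
      · have := h.out_unique _ _ _ h2 h1
        grind
      · have hp' : p < y := by grind
        have := h.out_unique _ _ _ h3 (ht.2 p (by omega) hp')
        grind
    · exact h1.1
    · have hr := h.odd_of_reach h1 hy hm hu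
      have ht := h.traverse _ _ h1 (by grind)
      have hpu := h.turn _ _ h2 (by grind)
      rcases hr.2.1.eq_or_lt with rfl | hlt
      · have := h.out_unique _ _ _ h2 h1
        grind
      · have hp' : p < y := by grind
        have := h.out_unique _ _ _ h3 (ht.2 p (by omega) hp')
        grind
  · intro hyz
    by_cases hp : Even y ↔ Even z
    · have ht := h.traverse _ _ hyz hp
      have hn : y = z + 2 * ((y - z) / 2) := by grind
      have hr := reflTransGen_of_climb (m := z) ((y - z) / 2) (by rw [← hn]; exact ht.2)
      rw [← hn] at hr
      by_cases hy : Even y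
      · left
        exact ⟨z, ⟨hyz, hy, hp.1 hy⟩, y, hr.1 (hp.1 hy), hyz, hy, hp.1 hy⟩
      · have hz : Odd z := by grind
        have hy : Odd y := by grind
        right; left
        exact ⟨z, ⟨hyz, hy, hz⟩, y, hr.2 hz, hyz, hy, hz⟩
    · by_cases hy : Even y
      · right; right; left; left
        exact ⟨hyz, hy, by grind⟩
      · right; right; right; left
        exact ⟨hyz, by grind, by grind⟩

/-- From m the only way is to climb to M, and M leads back to m. -/
theorem component_eq (h : CyclicFlow F) {M m : ℕ} (hMm : F M m) (hp : Even M ↔ Even m) :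
    {z | Relation.ReflTransGen F M z ∧ Relation.ReflTransGen F z M} = Set.Icc m M := by
  have ht := h.traverse _ _ hMm hp
  have up : ∀ n s, m ≤ s → s + n ≤ M → Relation.ReflTransGen F s (s + n) := by
    intro n s hs
    induction n with
    | zero => intro _; exact .refl
    | succ n ih => intro hn; exact (ih (by omega)).tail (ht.2 _ (by omega) (by omega))
  ext z
  constructor
  · rintro ⟨hz, hz'⟩
    clear hz'
    induction hz with
    | refl => exact ⟨ht.1, le_rfl⟩
    | @tail b c _ hbc ih =>
      rcases ih.2.eq_or_lt with rfl | hlt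
      · rw [h.out_unique _ _ _ hbc hMm]; exact ⟨le_rfl, ht.1⟩
      · have h1 := ih.1
        rw [h.out_unique _ _ _ hbc (ht.2 b h1 hlt)]; exact ⟨by omega, hlt⟩
  · rintro ⟨h1, h2⟩
    constructor
    · have := up (z - m) m le_rfl (by omega)
      rw [Nat.add_sub_cancel' h1] at this
      exact this.head hMm
    · have := up (M - z) z h1 (by omega)
      rwa [Nat.add_sub_cancel' h2] at this

end CyclicFlow

/-! ### Loops, components and traces -/

namespace Run

variable {Q α β : Type*} {T : TwoWayTransducer Q α β} {w : List α} {ρ : Run T w}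

theorem Inner.isIdempotentLoop [Fintype Q] {a d : ℕ} (h : ρ.Inner a d) (hn : ρ.Normalized)
    (hc : ρ.crossing a = ρ.crossing d) (hF : CyclicFlow (ρ.flow a d)) :
    ρ.IsIdempotentLoop a d := by
  refine ⟨⟨⟨h.lt, h.le⟩, hc⟩, ?_⟩
  have hv := h.isValid hn
  have he : (⟨flowComp (ρ.effect a d).flow (ρ.effect a d).flow, (ρ.effect a d).left,
      (ρ.effect a d).right⟩ : Effect Q) = ρ.effect a d := by
    simp only [effect, hF.flowComp_self]
  unfold Effect.mul
  rw [he, if_pos ⟨hc.symm, hv⟩]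

/-- The trace of the cycle through a traversing factor contains this factor. -/
theorem Inner.exists_trace {a d i j t : ℕ} (h : ρ.Inner a d) (hF : CyclicFlow (ρ.flow a d))
    (hij : ρ.Intercepted a d i j) (hp : Even (ρ.level i) ↔ Even (ρ.level j))
    (hit : i ≤ t) (htj : t < j) (hout : (ρ.rule t).out ≠ []) :
    ρ.IsComponent a d (Set.Icc (ρ.level j) (ρ.level i)) ∧
    anchor a d (Set.Icc (ρ.level j) (ρ.level i)) = ρ.loc i ∧
    ∃ τ, ρ.IsTrace a d (Set.Icc (ρ.level j) (ρ.level i)) τ ∧ outputOf τ ≠ [] := by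
  have hfl : ρ.flow a d (ρ.level i) (ρ.level j) := h.flow_iff.2 ⟨i, j, hij, rfl, rfl⟩
  have ht := hF.traverse _ _ hfl hp
  have hs := h.start hij
  rw [← Nat.not_even_iff_odd] at hs
  refine ⟨⟨ρ.level i, ?_, (hF.component_eq hfl hp).symm⟩, ?_, ?_⟩
  · have := ρ.level_lt_crossing (i := i) (hij.1.le.trans hij.2.1)
    rw [lt_max_iff]
    rcases hs.2 with hs | hs
    · left; rwa [hs.1] at this
    · right; rwa [hs.1] at this
  · unfold anchor
    -- Minimum and maximum have equal parity, so the parity of the minimum tells at which border the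
    -- factor starts.
    rw [csInf_Icc ht.1, csSup_Icc ht.1]
    split_ifs <;> simp only [loc, Prod.mk.injEq, and_true] <;> tauto
  · have hch : ∀ n, ∃ s e, n < ρ.level i - ρ.level j →
        ρ.EdgeFactor a d (ρ.level j + n) (ρ.level j + n + 1) s e := by
      intro n
      by_cases hn : n < ρ.level i - ρ.level j
      · obtain ⟨s, e, hse⟩ := ht.2 (ρ.level j + n) (by omega) (by omega)
        exact ⟨s, e, fun _ => hse⟩
      · exact ⟨0, 0, fun h => absurd h hn⟩
    choose s e hse using hch
    have hedge : ρ.EdgeFactor a d (ρ.level i) (ρ.level j) i j := by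
      refine ⟨hij, ?_, ?_⟩
      · rcases h.start hij with ⟨_, hi | hi⟩ <;> simp [loc, hi.1]
      · rcases h.finish hij with hi | hi <;> simp [loc, hi.1]
    -- The cycle starts at its maximum with the traversing factor; index n + 1 is the climbing edge
    -- out of the n-th level above the minimum.
    refine ⟨_, ⟨ρ.level i - ρ.level j,
      fun n => match n with | 0 => ρ.level i | n + 1 => ρ.level j + n,
      fun n => match n with | 0 => i | n + 1 => s n,
      fun n => match n with | 0 => j | n + 1 => e n, ?_, ?_, ⟨?_, ?_, ?_⟩, ?_, rfl⟩, ?_⟩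
    · exact (csSup_Icc ht.1).symm
    · rw [csSup_Icc ht.1]
      exact Nat.add_sub_cancel' ht.1
    · rintro (_ | n) hn
      · exact ⟨ht.1, le_rfl⟩
      · simp only [Set.mem_Iic] at hn
        exact ⟨by simp, by simp only; omega⟩
    · rintro (_ | n) hn (_ | n') hn' heq <;> simp only [Set.mem_Iic] at hn hn' heq <;> omega
    · rintro z ⟨hz1, hz2⟩
      rcases hz2.eq_or_lt with rfl | hz2
      · exact ⟨0, by simp, rfl⟩
      · exact ⟨z - ρ.level j + 1, by simp only [Set.mem_Iic]; omega, by simp only; omega⟩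
    · rintro (_ | n) hn
      · exact hedge
      · exact hse n (by omega)
    · intro hnil
      simp only [outputOf, List.flatMap_eq_nil_iff, List.mem_flatMap] at hnil
      refine hout (hnil _ ⟨0, by simp, ?_⟩)
      simp only [factor, List.mem_map, List.Ico.mem]
      exact ⟨t, ⟨hit, htj⟩, rfl⟩

/-- If consecutive intervals and all their unions have the same flow, then the factors of the union
that enter the middle interval are traversing. -/
theorem Inner.traversing_of_middle {a b c d i j t : ℕ} (hab : ρ.Inner a b) (hcd : ρ.Inner c d)
    (had : ρ.Inner a d) (h1 : ρ.flow a b = ρ.flow a d) (h2 : ρ.flow c d = ρ.flow a d)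
    (hij : ρ.Intercepted a d i j) (hit : i ≤ t) (htj : t < j) (ht : ρ.Inside b c t) :
    Even (ρ.level i) ↔ Even (ρ.level j) := by
  have hfl : ρ.flow a d (ρ.level i) (ρ.level j) := had.flow_iff.2 ⟨i, j, hij, rfl, rfl⟩
  have hfl1 := hfl
  have hfl2 := hfl
  rw [← h1, hab.flow_iff] at hfl1
  rw [← h2, hcd.flow_iff] at hfl2
  obtain ⟨i1, j1, hij1, hi1, hj1⟩ := hfl1
  obtain ⟨i2, j2, hij2, hi2, hj2⟩ := hfl2
  have s := had.start hij
  have f := had.finish hij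
  have s1 := hab.start hij1
  have f1 := hab.finish hij1
  have s2 := hcd.start hij2
  have f2 := hcd.finish hij2
  simp only [← Nat.not_even_iff_odd, hi1, hj1, hi2, hj2] at s f s1 f1 s2 f2
  rw [inside_iff] at ht
  -- A turning factor has the same end locations as the factor of [a, b] or of [c, d] for the same
  -- edge. It is then that factor, and never enters [b, c].
  by_contra hp
  by_cases hi : Even (ρ.level i)
  · have e1 : i = i1 := ρ.loc_injective (by grind) hi1.symm
    have e2 : j = j1 := ρ.loc_injective (by grind) hj1.symm
    subst e1 e2
    have := hij1.2.2.1 t hit htj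
    rw [inside_iff] at this
    omega
  · have e1 : i = i2 := ρ.loc_injective (by grind) hi2.symm
    have e2 : j = j2 := ρ.loc_injective (by grind) hj2.symm
    subst e1 e2
    have := hij2.2.2.1 t hit htj
    rw [inside_iff] at this
    omega

end Run

/-! ### Traversing levels determine the flow -/

namespace Run

variable {Q α β : Type*} {T : TwoWayTransducer Q α β} {w : List α} {ρ : Run T w} {x y : ℕ}

/-- The level `l` at the left border is joined to the level `r` at the right border by a traversing
factor, in one of the two directions. -/
def Joined (ρ : Run T w) (x y l r : ℕ) : Prop :=
  (Even l ∧ Even r ∧ ρ.flow x y l r) ∨ (Odd l ∧ Odd r ∧ ρ.flow x y r l)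

open Classical in
/-- The levels at the left border at which traversing factors start or end. -/
noncomputable def leftLevels (ρ : Run T w) (x y : ℕ) : Finset ℕ :=
  (Finset.range (ρ.crossing x).length).filter fun l => ∃ r, ρ.Joined x y l r

open Classical in
/-- The levels at the right border at which traversing factors start or end. -/
noncomputable def rightLevels (ρ : Run T w) (x y : ℕ) : Finset ℕ :=
  (Finset.range (ρ.crossing y).length).filter fun r => ∃ l, ρ.Joined x y l r

theorem leftLevels_subset_range : ρ.leftLevels x y ⊆ Finset.range (ρ.crossing x).length := by
  classical exact Finset.filter_subset _ _

theorem rightLevels_subset_range : ρ.rightLevels x y ⊆ Finset.range (ρ.crossing y).length := by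
  classical exact Finset.filter_subset _ _

/-- Treats both directions at once: p and q are the ends of the factor at the left and right border,
in either order. -/
theorem Inner.exists_times (h : ρ.Inner x y) {l r : ℕ} (hj : ρ.Joined x y l r) :
    ∃ i j p q, ρ.Intercepted x y i j ∧ ρ.pos p = x ∧ ρ.level p = l ∧ ρ.pos q = y ∧
      ρ.level q = r ∧ i ≤ p ∧ p ≤ j ∧ i ≤ q ∧ q ≤ j := by
  rcases hj with ⟨h1, h2, h3⟩ | ⟨h1, h2, h3⟩ <;> rw [h.flow_iff] at h3 <;>
    obtain ⟨i, j, hij, rfl, rfl⟩ := h3 <;> have s := h.start hij <;> have f := h.finish hij <;>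
    have := hij.1
  · exact ⟨i, j, i, j, hij, by grind, rfl, by grind, rfl, by omega, by omega, by omega, by omega⟩
  · exact ⟨i, j, j, i, hij, by grind, rfl, by grind, rfl, by omega, by omega, by omega, by omega⟩

variable [Fintype Q]

theorem Inner.mem_leftLevels (h : ρ.Inner x y) (hn : ρ.Normalized) {l : ℕ} :
    l ∈ ρ.leftLevels x y ↔ ∃ r, ρ.Joined x y l r := by
  have hv := h.isValid hn
  simp only [leftLevels, Finset.mem_filter, Finset.mem_range, and_iff_right_iff_imp]
  rintro ⟨r, ⟨h1, _, h3⟩ | ⟨h1, _, h3⟩⟩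
  · exact (hv.even_out l h1).1 ⟨r, h3⟩
  · exact (hv.odd_in l h1).1 ⟨r, h3⟩

theorem Inner.mem_rightLevels (h : ρ.Inner x y) (hn : ρ.Normalized) {r : ℕ} :
    r ∈ ρ.rightLevels x y ↔ ∃ l, ρ.Joined x y l r := by
  have hv := h.isValid hn
  simp only [rightLevels, Finset.mem_filter, Finset.mem_range, and_iff_right_iff_imp]
  rintro ⟨l, ⟨_, h1, h3⟩ | ⟨_, h1, h3⟩⟩
  · exact (hv.even_in r h1).1 ⟨l, h3⟩
  · exact (hv.odd_out r h1).1 ⟨l, h3⟩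

theorem Inner.joined_right_unique (h : ρ.Inner x y) (hn : ρ.Normalized) {l r r' : ℕ}
    (h1 : ρ.Joined x y l r) (h2 : ρ.Joined x y l r') : r = r' := by
  have hv := h.isValid hn
  rcases h1 with ⟨a1, _, a3⟩ | ⟨a1, _, a3⟩ <;> rcases h2 with ⟨b1, _, b3⟩ | ⟨b1, _, b3⟩
  · exact hv.out_unique _ _ _ a3 b3
  · grind
  · grind
  · exact hv.in_unique _ _ _ a3 b3

theorem Inner.joined_left_unique (h : ρ.Inner x y) (hn : ρ.Normalized) {l l' r : ℕ}
    (h1 : ρ.Joined x y l r) (h2 : ρ.Joined x y l' r) : l = l' := by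
  have hv := h.isValid hn
  rcases h1 with ⟨_, a1, a3⟩ | ⟨_, a1, a3⟩ <;> rcases h2 with ⟨_, b1, b3⟩ | ⟨_, b1, b3⟩
  · exact hv.in_unique _ _ _ a3 b3
  · grind
  · grind
  · exact hv.out_unique _ _ _ a3 b3

theorem Inner.card_leftLevels (h : ρ.Inner x y) (hn : ρ.Normalized) :
    (ρ.leftLevels x y).card = (ρ.rightLevels x y).card := by
  refine Finset.card_bij (fun l hl => ((h.mem_leftLevels hn).1 hl).choose) ?_ ?_ ?_
  · intro l hl
    exact (h.mem_rightLevels hn).2 ⟨l, ((h.mem_leftLevels hn).1 hl).choose_spec⟩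
  · intro l hl l' hl' heq
    have h1 := ((h.mem_leftLevels hn).1 hl).choose_spec
    have h2 := ((h.mem_leftLevels hn).1 hl').choose_spec
    rw [← heq] at h2
    exact h.joined_left_unique hn h1 h2
  · intro r hr
    obtain ⟨l, hl⟩ := (h.mem_rightLevels hn).1 hr
    have hl' := (h.mem_leftLevels hn).2 ⟨r, hl⟩
    exact ⟨l, hl', h.joined_right_unique hn ((h.mem_leftLevels hn).1 hl').choose_spec hl⟩

/-- Distinct traversing factors occupy disjoint stretches of time, so the levels at both borders are
ordered by time in the same way. -/
theorem Inner.joined_strictMono (h : ρ.Inner x y) (hn : ρ.Normalized) {l l' r r' : ℕ}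
    (hj : ρ.Joined x y l r) (hj' : ρ.Joined x y l' r') (hl : l < l') : r < r' := by
  have hne : r ≠ r' := by
    rintro rfl
    exact hl.ne (h.joined_left_unique hn hj hj')
  obtain ⟨i, j, p, q, hij, hp, rfl, hq, rfl, h1, h2, h3, h4⟩ := h.exists_times hj
  obtain ⟨i', j', p', q', hij', hp', rfl, hq', rfl, h1', h2', h3', h4'⟩ := h.exists_times hj'
  have a1 := hij.1
  have a2 := hij'.1
  have hpp : p < p' := by
    by_contra hc
    rcases (not_lt.1 hc).eq_or_lt with rfl | hc
    · omega
    · have := ρ.level_lt_level hc (by rw [hp, hp']); omega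
  by_contra hc
  have hqq : q' < q := by
    by_contra hd
    rcases (not_lt.1 hd).eq_or_lt with rfl | hd
    · omega
    · have := ρ.level_lt_level hd (by rw [hq, hq']); omega
  -- Opposite orders at the two borders would make the factors overlap in time, hence coincide.
  have hsame : i = i' ∧ j = j' :=
    hij.unique hij' (t := max i i') (by omega) (by omega) (by omega) (by omega)
  obtain ⟨rfl, rfl⟩ := hsame
  have hs := h.start hij
  have hf := h.finish hij
  have hxy := h.lt
  have hin := hij.2.2.1
  have hlen := hij.2.1
  simp only [inside_iff] at hin
  have hend : ∀ t, i < t → t < j → ρ.pos t ≠ x ∧ ρ.pos t ≠ y := by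
    intro t h1 h2
    have b1 := hin t h1.le h2
    have b2 := hin (t - 1) (by omega) (by omega)
    have hc := ρ.step_cases (i := t - 1) (by omega)
    rw [Nat.sub_add_cancel (by omega)] at hc
    omega
  have e : ∀ t, i ≤ t → t ≤ j → (ρ.pos t = x ∨ ρ.pos t = y) → t = i ∨ t = j := by
    intro t h1 h2 h3
    by_contra hc
    have := hend t (by omega) (by omega)
    omega
  have e1 := e p h1 h2 (Or.inl hp)
  have e2 := e p' h1' h2' (Or.inl hp')
  have e3 := e q h3 h4 (Or.inr hq)
  have : p = i := by omega
  have : p' = j := by omega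
  subst this
  rcases e3 with rfl | rfl <;> omega

/-- An increasing bijection between two given finite sets of levels is unique. -/
theorem joined_eq {x' y' : ℕ} (h : ρ.Inner x y) (h' : ρ.Inner x' y') (hn : ρ.Normalized)
    (hL : ρ.leftLevels x y = ρ.leftLevels x' y') (hR : ρ.rightLevels x y = ρ.rightLevels x' y')
    (l : ℕ) : ∀ r, ρ.Joined x y l r ↔ ρ.Joined x' y' l r := by
  induction l using Nat.strong_induction_on with
  | _ l ih =>
    have main : ∀ {x y x' y' : ℕ}, ρ.Inner x y → ρ.Inner x' y' →
        ρ.leftLevels x y = ρ.leftLevels x' y' → ρ.rightLevels x y = ρ.rightLevels x' y' →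
        (∀ m < l, ∀ r, ρ.Joined x y m r ↔ ρ.Joined x' y' m r) →
        ∀ r, ρ.Joined x y l r → ρ.Joined x' y' l r := by
      intro x y x' y' h h' hL hR ih r hr
      obtain ⟨r', hr'⟩ := (h'.mem_leftLevels hn).1 (hL ▸ (h.mem_leftLevels hn).2 ⟨r, hr⟩)
      -- If the partners of l differ, the smaller one has, in the other interval, a partner m < l;
      -- the induction hypothesis then gives it two partners in one interval.
      rcases lt_trichotomy r r' with hlt | rfl | hlt
      · obtain ⟨m, hm⟩ := (h'.mem_rightLevels hn).1 (hR ▸ (h.mem_rightLevels hn).2 ⟨l, hr⟩)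
        have hml : m < l := by
          by_contra hc
          rcases (not_lt.1 hc).eq_or_lt with rfl | hc
          · exact hlt.ne (h'.joined_right_unique hn hm hr')
          · exact absurd (h'.joined_strictMono hn hr' hm hc) (by omega)
        have := h.joined_left_unique hn ((ih m hml r).2 hm) hr
        omega
      · exact hr'
      · obtain ⟨m, hm⟩ := (h.mem_rightLevels hn).1 (hR.symm ▸ (h'.mem_rightLevels hn).2 ⟨l, hr'⟩)
        have hml : m < l := by
          by_contra hc
          rcases (not_lt.1 hc).eq_or_lt with rfl | hc
          · exact hlt.ne (h.joined_right_unique hn hm hr)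
          · exact absurd (h.joined_strictMono hn hr hm hc) (by omega)
        have := h'.joined_left_unique hn ((ih m hml r').1 hm) hr'
        omega
    exact fun r => ⟨main h h' hL hR ih r,
      main h' h hL.symm hR.symm (fun m hm r => (ih m hm r).symm) r⟩

/-- The flow is determined by the lengths of the crossing sequences and the traversing levels. -/
theorem flow_eq {x' y' : ℕ} (h : ρ.Inner x y) (h' : ρ.Inner x' y') (hn : ρ.Normalized)
    (hx : (ρ.crossing x).length = (ρ.crossing x').length)
    (hy : (ρ.crossing y).length = (ρ.crossing y').length)
    (hL : ρ.leftLevels x y = ρ.leftLevels x' y') (hR : ρ.rightLevels x y = ρ.rightLevels x' y') :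
    ρ.flow x y = ρ.flow x' y' := by
  have main : ∀ {x y x' y' : ℕ}, ρ.Inner x y → ρ.Inner x' y' →
      (ρ.crossing x).length = (ρ.crossing x').length →
      (ρ.crossing y).length = (ρ.crossing y').length →
      ρ.leftLevels x y = ρ.leftLevels x' y' → ρ.rightLevels x y = ρ.rightLevels x' y' →
      ∀ u v, ρ.flow x y u v → ρ.flow x' y' u v := by
    intro x y x' y' h h' hx hy hL hR u v huv
    have hj := joined_eq h h' hn hL hR
    have hv := h.isValid hn
    have hv' := h'.isValid hn
    by_cases hp : Even u ↔ Even v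
    · by_cases hu : Even u
      · rcases (hj u v).1 (Or.inl ⟨hu, hp.1 hu, huv⟩) with h1 | h1
        · exact h1.2.2
        · grind
      · have hu' : Odd u := by grind
        have hv' : Odd v := by grind
        rcases (hj v u).1 (Or.inr ⟨hv', hu', huv⟩) with h1 | h1
        · grind
        · exact h1.2.2
    · have e := h.flow_turn huv hp
      by_cases hu : Even u
      · obtain ⟨v', hv1⟩ := (hv'.even_out u hu).2 (hx ▸ (hv.even_out u hu).1 ⟨v, huv⟩)
        by_cases hve : Even v'
        · rcases (hj u v').2 (Or.inl ⟨hu, hve, hv1⟩) with h1 | h1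
          · have := hv.out_unique _ _ _ huv h1.2.2
            grind
          · grind
        · rw [e, ← h'.flow_turn hv1 (by tauto)]; exact hv1
      · have hu' : Odd u := by grind
        obtain ⟨v', hv1⟩ := (hv'.odd_out u hu').2 (hy ▸ (hv.odd_out u hu').1 ⟨v, huv⟩)
        by_cases hve : Even v'
        · rw [e, ← h'.flow_turn hv1 (by tauto)]; exact hv1
        · rcases (hj v' u).2 (Or.inr ⟨by grind, hu', hv1⟩) with h1 | h1
          · grind
          · have := hv.out_unique _ _ _ huv h1.2.2
            grind
  ext u v
  exact ⟨main h h' hx hy hL hR u v, main h' h hx.symm hy.symm hL.symm hR.symm u v⟩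

/-- A factor traversing [x, z] passes y, and its piece next to the left border traverses [x, y]. -/
theorem Inner.leftLevels_subset {z : ℕ} (h : ρ.Inner x y) (h' : ρ.Inner x z) (hyz : y ≤ z)
    (hn : ρ.Normalized) : ρ.leftLevels x z ⊆ ρ.leftLevels x y := by
  have hv := h.isValid hn
  have hv' := h'.isValid hn
  intro l hl
  rw [h'.mem_leftLevels hn] at hl
  rw [h.mem_leftLevels hn]
  have hxy := h.lt
  obtain ⟨r, ⟨h1, h2, h3⟩ | ⟨h1, h2, h3⟩⟩ := hl
  · obtain ⟨v, hv1⟩ := (hv.even_out l h1).2 ((hv'.even_out l h1).1 ⟨r, h3⟩)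
    refine ⟨v, Or.inl ⟨h1, ?_, hv1⟩⟩
    by_contra hve
    change ρ.flow x y l v at hv1
    rw [h'.flow_iff] at h3
    rw [h.flow_iff] at hv1
    obtain ⟨i, j, hij, rfl, rfl⟩ := h3
    obtain ⟨i', j', hij', hl', rfl⟩ := hv1
    have s := h'.start hij
    have s' := h.start hij'
    have f := h'.finish hij
    have f' := h.finish hij'
    simp only [← Nat.not_even_iff_odd, hl'] at s s' f f'
    have e : i' = i := ρ.loc_injective (by grind) hl'
    subst e
    have l1 := hij.1
    have l2 := hij'.1
    have hne : j ≠ j' := by rintro rfl; grind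
    rcases lt_or_gt_of_ne hne with hlt | hlt
    · have := hij'.2.2.1 j l1.le hlt
      rw [inside_iff] at this
      grind
    · have := hij.2.2.1 j' l2.le hlt
      rw [inside_iff] at this
      grind
  · obtain ⟨u, hu1⟩ := (hv.odd_in l h1).2 ((hv'.odd_in l h1).1 ⟨r, h3⟩)
    refine ⟨u, Or.inr ⟨h1, ?_, hu1⟩⟩
    rw [← Nat.not_even_iff_odd]
    intro hue
    change ρ.flow x y u l at hu1
    rw [h'.flow_iff] at h3
    rw [h.flow_iff] at hu1
    obtain ⟨i, j, hij, rfl, rfl⟩ := h3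
    obtain ⟨i', j', hij', rfl, hl'⟩ := hu1
    have s := h'.start hij
    have s' := h.start hij'
    have f := h'.finish hij
    have f' := h.finish hij'
    simp only [← Nat.not_even_iff_odd, hl'] at s s' f f' h1 h2
    have e : j' = j := ρ.loc_injective (by grind) hl'
    subst e
    have l1 := hij.1
    have l2 := hij'.1
    have hne : i ≠ i' := by rintro rfl; grind
    rcases lt_or_gt_of_ne hne with hlt | hlt
    · have := hij.2.2.1 (i' - 1) (by omega) (by omega)
      rw [inside_iff] at this
      grind
    · have := hij'.2.2.1 (i - 1) (by omega) (by omega)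
      rw [inside_iff] at this
      grind

theorem Inner.rightLevels_subset {z : ℕ} (h : ρ.Inner y z) (h' : ρ.Inner x z) (hxy : x ≤ y)
    (hn : ρ.Normalized) : ρ.rightLevels x z ⊆ ρ.rightLevels y z := by
  have hv := h.isValid hn
  have hv' := h'.isValid hn
  intro r hr
  rw [h'.mem_rightLevels hn] at hr
  rw [h.mem_rightLevels hn]
  have hxy := h.lt
  obtain ⟨l, ⟨h2, h1, h3⟩ | ⟨h2, h1, h3⟩⟩ := hr
  · obtain ⟨u, hu1⟩ := (hv.even_in r h1).2 ((hv'.even_in r h1).1 ⟨l, h3⟩)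
    refine ⟨u, Or.inl ⟨?_, h1, hu1⟩⟩
    by_contra hue
    change ρ.flow y z u r at hu1
    rw [h'.flow_iff] at h3
    rw [h.flow_iff] at hu1
    obtain ⟨i, j, hij, rfl, rfl⟩ := h3
    obtain ⟨i', j', hij', rfl, hl'⟩ := hu1
    have s := h'.start hij
    have s' := h.start hij'
    have f := h'.finish hij
    have f' := h.finish hij'
    simp only [← Nat.not_even_iff_odd, hl'] at s s' f f'
    have e : j' = j := ρ.loc_injective (by grind) hl'
    subst e
    have l1 := hij.1
    have l2 := hij'.1
    have hne : i ≠ i' := by rintro rfl; grind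
    rcases lt_or_gt_of_ne hne with hlt | hlt
    · have := hij.2.2.1 (i' - 1) (by omega) (by omega)
      rw [inside_iff] at this
      grind
    · have := hij'.2.2.1 (i - 1) (by omega) (by omega)
      rw [inside_iff] at this
      grind
  · obtain ⟨v, hv1⟩ := (hv.odd_out r h1).2 ((hv'.odd_out r h1).1 ⟨l, h3⟩)
    refine ⟨v, Or.inr ⟨?_, h1, hv1⟩⟩
    rw [← Nat.not_even_iff_odd]
    intro hve
    change ρ.flow y z r v at hv1
    rw [h'.flow_iff] at h3
    rw [h.flow_iff] at hv1
    obtain ⟨i, j, hij, rfl, rfl⟩ := h3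
    obtain ⟨i', j', hij', hl', rfl⟩ := hv1
    have s := h'.start hij
    have s' := h.start hij'
    have f := h'.finish hij
    have f' := h.finish hij'
    simp only [← Nat.not_even_iff_odd, hl'] at s s' f f' h1 h2
    have e : i' = i := ρ.loc_injective (by grind) hl'
    subst e
    have l1 := hij.1
    have l2 := hij'.1
    have hne : j ≠ j' := by rintro rfl; grind
    rcases lt_or_gt_of_ne hne with hlt | hlt
    · have := hij'.2.2.1 j l1.le hlt
      rw [inside_iff] at this
      grind
    · have := hij.2.2.1 j' l2.le hlt
      rw [inside_iff] at this
      grind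

/-- The top level at x is even because the crossing length is odd. A turn from it would lead to a
level that does not exist. -/
theorem Inner.leftLevels_nonempty (h : ρ.Inner x y) (hn : ρ.Normalized) :
    0 < (ρ.leftLevels x y).card := by
  have hv := h.isValid hn
  obtain ⟨k, hk⟩ := h.succ.odd_crossing (h.lt.le.trans h.le)
  have he : Even (2 * k) := even_two_mul k
  obtain ⟨v, huv⟩ := (hv.even_out _ he).2 (show 2 * k < (ρ.crossing x).length by omega)
  rw [Finset.card_pos]
  refine ⟨2 * k, (h.mem_leftLevels hn).2 ⟨v, Or.inl ⟨he, ?_, huv⟩⟩⟩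
  by_contra hc
  have := h.flow_turn huv (by tauto)
  have : v < (ρ.crossing x).length := (hv.odd_in v (by grind)).1 ⟨_, huv⟩
  omega

end Run

/-! ### A chain argument for monotone interval functions -/

/-- Among sufficiently many positions, there are many between which a quantity that decreases with
the length of the interval is constant. -/
theorem exists_subset_constant (g : ℕ → ℕ → ℕ) (q H : ℕ) (v : ℕ) (S : Finset ℕ)
    (hg : ∀ x ∈ S, ∀ y ∈ S, ∀ z ∈ S, x ≤ y → y < z → g x z ≤ g y z)
    (hv : ∀ x ∈ S, ∀ y ∈ S, x < y → v ≤ g x y ∧ g x y < v + H) (hS : q ^ H < S.card) :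
    ∃ U ⊆ S, q < U.card ∧ ∃ c, ∀ x ∈ U, ∀ y ∈ U, x < y → g x y = c := by
  classical
  induction H generalizing S v with
  | zero =>
    rw [pow_zero, Finset.one_lt_card] at hS
    obtain ⟨x, hx, y, hy, hne⟩ := hS
    rcases lt_or_gt_of_ne hne with h | h
    · have := hv x hx y hy h; omega
    · have := hv y hy x hx h; omega
  | succ H ih =>
    let chains (y : ℕ) : Finset (Finset ℕ) := (S.filter (· ≤ y)).powerset.filter fun U =>
      ∀ s ∈ U, ∀ t ∈ U, s < t → g s t = v
    have hmem : ∀ y U, U ∈ chains y ↔ (∀ s ∈ U, s ∈ S ∧ s ≤ y) ∧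
        ∀ s ∈ U, ∀ t ∈ U, s < t → g s t = v := by
      intro y U
      simp only [chains, Finset.mem_filter, Finset.mem_powerset, Finset.subset_iff]
    -- Without a chain of more than q positions of least value v, label each position y by the size
    -- of a longest such chain up to y.
    let len (y : ℕ) : ℕ := (chains y).sup Finset.card
    by_cases hlong : ∃ y, q < len y
    · obtain ⟨y, hy⟩ := hlong
      obtain ⟨U, hU, hc⟩ := (Finset.lt_sup_iff).1 hy
      rw [hmem] at hU
      exact ⟨U, fun s hs => (hU.1 s hs).1, hc, v, hU.2⟩
    · push Not at hlong
      have hmaps : ∀ y ∈ S, len y ∈ Finset.Icc 1 q := by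
        intro y hy
        refine Finset.mem_Icc.2 ⟨?_, hlong y⟩
        have : ({y} : Finset ℕ) ∈ chains y := by
          rw [hmem]
          simp [hy]
        have := Finset.le_sup (f := Finset.card) this
        rwa [Finset.card_singleton] at this
      obtain ⟨k, _, hk⟩ := Finset.exists_lt_card_fiber_of_mul_lt_card_of_maps_to
        (n := q ^ H) hmaps (by rw [Nat.card_Icc, Nat.add_sub_cancel]; rwa [pow_succ'] at hS)
      have hfib : ∀ x ∈ S.filter (fun y => len y = k), ∀ y ∈ S.filter (fun y => len y = k),
          x < y → v + 1 ≤ g x y ∧ g x y < v + 1 + H := by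
        intro x hx y hy hxy
        rw [Finset.mem_filter] at hx hy
        have hvxy := hv x hx.1 y hy.1 hxy
        -- If g x y = v, then y extends a longest chain up to x: monotonicity gives g s y ≤ g x y =
        -- v for s ≤ x. Equal labels therefore exclude v and leave one value fewer.
        suffices g x y ≠ v by omega
        intro hgv
        obtain ⟨U, hU, hUc⟩ := Finset.exists_mem_eq_sup (chains x)
          ⟨∅, by rw [hmem]; simp⟩ Finset.card
        rw [hmem] at hU
        have hyU : y ∉ U := fun h => by have := (hU.1 y h).2; omega
        have hins : insert y U ∈ chains y := by
          rw [hmem]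
          constructor
          · intro s hs
            rcases Finset.mem_insert.1 hs with rfl | hs
            · exact ⟨hy.1, le_rfl⟩
            · exact ⟨(hU.1 s hs).1, (hU.1 s hs).2.trans hxy.le⟩
          · intro s hs t ht hst
            rcases Finset.mem_insert.1 hs with rfl | hs' <;>
              rcases Finset.mem_insert.1 ht with rfl | ht'
            · omega
            · have := (hU.1 t ht').2; omega
            · have h1 := hU.1 s hs'
              have h2 := hg s h1.1 x hx.1 t hy.1 h1.2 hxy
              have h3 := hv s h1.1 t hy.1 (by omega)
              omega
            · exact hU.2 s hs' t ht' hst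
        have := Finset.le_sup (f := Finset.card) hins
        rw [Finset.card_insert_of_notMem hyU] at this
        change U.card + 1 ≤ len y at this
        change len x = U.card at hUc
        omega
      obtain ⟨U, hU, h1, h2⟩ := ih (v + 1) (S.filter fun y => len y = k)
        (fun x hx y hy z hz => hg x (Finset.mem_of_mem_filter _ hx) y
          (Finset.mem_of_mem_filter _ hy) z (Finset.mem_of_mem_filter _ hz)) hfib hk
      exact ⟨U, hU.trans (Finset.filter_subset _ _), h1, h2⟩

/-! ### Positions with uniform effects -/

namespace Run

variable {Q α β : Type*} {T : TwoWayTransducer Q α β} {w : List α} {ρ : Run T w}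

/-- Among sufficiently many positions, there are eight such that all intervals between them have
the same effect. -/
theorem exists_uniform_positions [Fintype Q] (hρ : ρ.Successful) (hn : ρ.Normalized) (S : Finset ℕ)
    (hS : ∀ x ∈ S, 0 < x ∧ x ≤ (tape w).length)
    (hcard : (7 * (4 * (Fintype.card Q + 1)) ^ hmax Q + 2) ^ hmax Q < S.card) :
    ∃ U ⊆ S, 7 < U.card ∧ (∀ x ∈ U, ∀ y ∈ U, ρ.crossing x = ρ.crossing y) ∧
      ∃ F, ∀ x ∈ U, ∀ y ∈ U, x < y → ρ.flow x y = F := by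
  classical
  have hI : ∀ x ∈ S, ∀ y ∈ S, x < y → ρ.Inner x y := fun x hx y hy hxy =>
    ⟨hρ, (hS x hx).1, hxy, (hS y hy).2⟩
  -- The number of traversing levels lies between 1 and h_max. In the constant, 7 times the number
  -- of colours serves the pigeonhole below, and 2 pays for removing the extreme positions.
  obtain ⟨V, hVS, hVc, c, hc⟩ := exists_subset_constant (fun x y => (ρ.leftLevels x y).card)
    (7 * (4 * (Fintype.card Q + 1)) ^ hmax Q + 2) (hmax Q) 1 S (by
      intro x hx y hy z hz hxy hyz
      have h1 := hI x hx z hz (by omega)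
      have h2 := hI y hy z hz hyz
      simp only [h1.card_leftLevels hn, h2.card_leftLevels hn]
      exact Finset.card_le_card (h2.rightLevels_subset h1 hxy hn)) (by
      intro x hx y hy hxy
      have h := hI x hx y hy hxy
      have h1 := Finset.card_le_card (leftLevels_subset_range (ρ := ρ) (x := x) (y := y))
      rw [Finset.card_range] at h1
      have h2 := hn.crossing_le hρ (hS x hx).2
      have h3 := h.leftLevels_nonempty hn
      constructor <;> omega) hcard
  have hVne : V.Nonempty := Finset.card_pos.1 (by omega)
  set lo := V.min' hVne
  set up := V.max' hVne
  have hlo : lo ∈ V := V.min'_mem hVne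
  have hup : up ∈ V := V.max'_mem hVne
  set W := (V.erase lo).erase up
  have hW : ∀ x ∈ W, x ∈ V ∧ lo < x ∧ x < up := by
    intro x hx
    simp only [W, Finset.mem_erase] at hx
    have h1 := V.min'_le x hx.2.2
    have h2 := V.le_max' x hx.2.2
    exact ⟨hx.2.2, by omega, by omega⟩
  have hWc : 7 * (4 * (Fintype.card Q + 1)) ^ hmax Q < W.card := by
    have h1 := Finset.pred_card_le_card_erase (s := V) (a := lo)
    have h2 := Finset.pred_card_le_card_erase (s := V.erase lo) (a := up)
    change _ ≤ W.card at h2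
    omega
  -- For each level: the state there, and whether it is traversing towards the fixed far ends `up`
  -- and `lo`.
  let color (x : ℕ) : Fin (hmax Q) → Option Q × Bool × Bool := fun k =>
    ((ρ.crossing x)[(k : ℕ)]?, decide ((k : ℕ) ∈ ρ.leftLevels x up),
      decide ((k : ℕ) ∈ ρ.rightLevels lo x))
  have hcolors : Fintype.card (Fin (hmax Q) → Option Q × Bool × Bool) =
      (4 * (Fintype.card Q + 1)) ^ hmax Q := by
    rw [Fintype.card_fun, Fintype.card_fin, Fintype.card_prod, Fintype.card_prod,
      Fintype.card_option, Fintype.card_bool]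
    congr 1
    omega
  obtain ⟨k, _, hk⟩ := Finset.exists_lt_card_fiber_of_mul_lt_card_of_maps_to (n := 7)
    (f := color) (s := W) (t := Finset.univ) (fun _ _ => Finset.mem_univ _)
    (by rw [Finset.card_univ, hcolors, mul_comm]; exact hWc)
  have hcol : ∀ x ∈ W.filter (fun x => color x = k), ∀ y ∈ W.filter (fun x => color x = k),
      ρ.crossing x = ρ.crossing y ∧ ρ.leftLevels x up = ρ.leftLevels y up ∧
        ρ.rightLevels lo x = ρ.rightLevels lo y := by
    intro x hx y hy
    rw [Finset.mem_filter] at hx hy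
    have hxy : color x = color y := hx.2.trans hy.2.symm
    have hlx := hn.crossing_le hρ (hS x (hVS (hW x hx.1).1)).2
    have hly := hn.crossing_le hρ (hS y (hVS (hW y hy.1).1)).2
    have hcr : ∀ m, m < hmax Q → (ρ.crossing x)[m]? = (ρ.crossing y)[m]? ∧
        (m ∈ ρ.leftLevels x up ↔ m ∈ ρ.leftLevels y up) ∧
        (m ∈ ρ.rightLevels lo x ↔ m ∈ ρ.rightLevels lo y) := by
      intro m hm
      have := congrFun hxy ⟨m, hm⟩
      simpa only [color, Prod.mk.injEq, decide_eq_decide] using this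
    have hbd : ∀ z, (ρ.crossing z).length ≤ hmax Q → ∀ m, hmax Q ≤ m →
        m ∉ ρ.leftLevels z up ∧ m ∉ ρ.rightLevels lo z := by
      intro z hz m hm
      constructor
      · intro h
        have := Finset.mem_range.1 (leftLevels_subset_range h)
        omega
      · intro h
        have := Finset.mem_range.1 (rightLevels_subset_range h)
        omega
    refine ⟨List.ext_getElem? fun m => ?_, Finset.ext fun m => ?_, Finset.ext fun m => ?_⟩ <;>
      rcases lt_or_ge m (hmax Q) with hm | hm
    · exact (hcr m hm).1
    · rw [List.getElem?_eq_none (by omega), List.getElem?_eq_none (by omega)]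
    · exact (hcr m hm).2.1
    · simp [(hbd x hlx m hm).1, (hbd y hly m hm).1]
    · exact (hcr m hm).2.2
    · simp [(hbd x hlx m hm).2, (hbd y hly m hm).2]
  set U := W.filter (fun x => color x = k)
  have hUW : U ⊆ W := Finset.filter_subset _ _
  -- The sets are nested and of equal size, so the other endpoint may be moved to the far end.
  have hL : ∀ x ∈ U, ∀ y ∈ U, x < y → ρ.leftLevels x y = ρ.leftLevels x up ∧
      ρ.rightLevels x y = ρ.rightLevels lo y := by
    intro x hx y hy hxy
    obtain ⟨hx1, hx2, hx3⟩ := hW x (hUW hx)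
    obtain ⟨hy1, hy2, hy3⟩ := hW y (hUW hy)
    have i1 := hI x (hVS hx1) y (hVS hy1) hxy
    have i2 := hI x (hVS hx1) up (hVS hup) hx3
    have i3 := hI lo (hVS hlo) y (hVS hy1) hy2
    have c1 := hc x hx1 y hy1 hxy
    have c2 := hc x hx1 up hup hx3
    have c3 := hc lo hlo y hy1 hy2
    constructor
    · exact (Finset.eq_of_subset_of_card_le (i1.leftLevels_subset i2 hy3.le hn)
        (by omega)).symm
    · simp only [i1.card_leftLevels hn, i3.card_leftLevels hn] at c1 c3
      exact (Finset.eq_of_subset_of_card_le (i1.rightLevels_subset i3 hx2.le hn)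
        (by omega)).symm
  have hUS : ∀ x ∈ U, x ∈ S := fun x hx => hVS (hW x (hUW hx)).1
  refine ⟨U, hUS, hk, fun x hx y hy => (hcol x hx y hy).1, ?_⟩
  obtain ⟨s, hs, t, ht, hst⟩ : ∃ s ∈ U, ∃ t ∈ U, s < t := by
    obtain ⟨s, hs, t, ht, hne⟩ := Finset.one_lt_card.1 (show 1 < U.card by omega)
    rcases lt_or_gt_of_ne hne with h | h
    · exact ⟨s, hs, t, ht, h⟩
    · exact ⟨t, ht, s, hs, h⟩
  refine ⟨ρ.flow s t, fun x hx y hy hxy => ?_⟩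
  refine flow_eq (hI x (hUS x hx) y (hUS y hy) hxy) (hI s (hUS s hs) t (hUS t ht) hst) hn
    (by rw [(hcol x hx s hs).1]) (by rw [(hcol y hy t ht).1]) ?_ ?_
  · rw [(hL x hx y hy hxy).1, (hL s hs t ht hst).1, (hcol x hx s hs).2.1]
  · rw [(hL x hx y hy hxy).2, (hL s hs t ht hst).2, (hcol y hy t ht).2.2]

end Run

/-- With p = 2n - 1 and s = (2n)^p, the base is at most (3s)² for n ≥ 2. Then 3s ≤ 2^s and p < s
give the exponent 3s². -/
theorem numeric_bound {n : ℕ} (hn : 1 ≤ n) :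
    2 * (7 * (4 * (n + 1)) ^ (2 * n - 1) + 2) ^ (2 * n - 1) + 4 ≤
      2 ^ (3 * (2 * n) ^ (2 * (2 * n - 1))) := by
  rcases hn.eq_or_lt with rfl | hn
  · norm_num
  · set p := 2 * n - 1
    set s := (2 * n) ^ p
    have hM : (4 * (n + 1)) ^ p ≤ s ^ 2 := by
      rw [← pow_mul, mul_comm p 2, pow_mul]
      exact Nat.pow_le_pow_left (by nlinarith) p
    have hs : (2 * n) ^ (2 * p) = s ^ 2 := by rw [mul_comm 2 p, pow_mul]
    rw [hs]
    have hps : p < s :=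
      Nat.lt_two_pow_self.trans_le (Nat.pow_le_pow_left (by omega) p)
    have hp : 3 ≤ p := by omega
    have h3 : ∀ m, 4 ≤ m → 3 * m ≤ 2 ^ m := by
      intro m hm
      induction m, hm using Nat.le_induction with
      | base => norm_num
      | succ m hm ih => rw [pow_succ]; omega
    have h1 : (7 * (4 * (n + 1)) ^ p + 2) ^ p ≤ 2 ^ (s * (2 * p)) := by
      calc (7 * (4 * (n + 1)) ^ p + 2) ^ p ≤ ((3 * s) ^ 2) ^ p :=
            Nat.pow_le_pow_left (by nlinarith) p
        _ = (3 * s) ^ (2 * p) := by rw [← pow_mul]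
        _ ≤ (2 ^ s) ^ (2 * p) := Nat.pow_le_pow_left (h3 s (by omega)) _
        _ = 2 ^ (s * (2 * p)) := by rw [← pow_mul]
    have h2 : 2 ≤ 2 ^ (s * (2 * p)) := Nat.le_self_pow (by positivity) 2
    calc _ ≤ 2 ^ (s * (2 * p) + 2) := by rw [pow_add]; omega
      _ ≤ 2 ^ (3 * s ^ 2) := Nat.pow_le_pow_right (by norm_num) (by nlinarith)

/-! ### From long output to a productive component -/

namespace Run

variable {Q α β : Type*} {T : TwoWayTransducer Q α β} {w : List α} {ρ : Run T w}

/-- The cut b makes the flow of [a, d] cyclic; b and c together make the factor through t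
traversing. -/
theorem exists_component_of_middle [Fintype Q] (hρ : ρ.Successful) (hn : ρ.Normalized)
    {U : Finset ℕ} {F : ℕ → ℕ → Prop} (hU : ∀ x ∈ U, 0 < x ∧ x ≤ (tape w).length)
    (hc : ∀ x ∈ U, ∀ y ∈ U, ρ.crossing x = ρ.crossing y)
    (hF : ∀ x ∈ U, ∀ y ∈ U, x < y → ρ.flow x y = F) {a b c d t : ℕ} (ha : a ∈ U) (hb : b ∈ U)
    (hc' : c ∈ U) (hd : d ∈ U) (hab : a < b) (hbc : b < c) (hcd : c < d) (ht : t < ρ.len)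
    (hin : ρ.Inside b c t) (hout : (ρ.rule t).out ≠ []) :
    ∃ C i, ρ.IsIdempotentLoop a d ∧ ρ.IsComponent a d C ∧ anchor a d C = ρ.loc i ∧ i ≤ t ∧
      (∀ k, i ≤ k → k ≤ t → ρ.Inside a d k) ∧ ∃ τ, ρ.IsTrace a d C τ ∧ outputOf τ ≠ [] := by
  have hI : ∀ x ∈ U, ∀ y ∈ U, x < y → ρ.Inner x y := fun x hx y hy hxy =>
    ⟨hρ, (hU x hx).1, hxy, (hU y hy).2⟩
  have had := hI a ha d hd (by omega)
  have hbd := hI b hb d hd (by omega)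
  have hab' := hI a ha b hb hab
  have hF1 := hF a ha d hd (by omega)
  have hF2 := hF a ha b hb hab
  have hF3 := hF b hb d hd (by omega)
  have hF4 := hF c hc' d hd hcd
  have hcyc : CyclicFlow (ρ.flow a d) :=
    ⟨(had.isValid hn).out_unique, fun u v huv => had.flow_turn huv, fun u v huv =>
      hab'.flow_traverse hbd had (by rw [hF1, hF2]) (by rw [hF1, hF3]) huv⟩
  obtain ⟨i, j, hij, hit, htj⟩ := had.exists_intercepted (t := t) ht
    (by rw [inside_iff] at hin ⊢; omega)
  have hp := hab'.traversing_of_middle (hI c hc' d hd hcd) had (by rw [hF1, hF2])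
    (by rw [hF1, hF4]) hij hit htj hin
  obtain ⟨h1, h2, h3⟩ := had.exists_trace hcyc hij hp hit htj hout
  exact ⟨_, i, had.isIdempotentLoop hn (hc a ha d hd) hcyc, h1, h2, hit,
    fun k hk hk' => hij.2.2.1 k hk (by omega), h3⟩

theorem length_output_le (c : ℕ) (l : List ℕ) (h : ∀ i ∈ l, (ρ.rule i).out.length ≤ c) :
    (outputOf (l.map ρ.rule)).length ≤
      c * (l.filter fun i => (ρ.rule i).out ≠ []).length := by
  induction l with
  | nil => simp [outputOf]
  | cons i l ih =>
    have ih := ih fun j hj => h j (List.mem_cons_of_mem _ hj)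
    have hi := h i List.mem_cons_self
    simp only [outputOf, List.map_cons, List.flatMap_cons, List.length_append] at ih ⊢
    by_cases ho : (ρ.rule i).out = []
    · simpa [ho] using ih
    · rw [List.filter_cons_of_pos (by simpa using ho), List.length_cons, mul_add]
      omega

theorem output_le_cmax {i : ℕ} (hi : i < ρ.len) : (ρ.rule i).out.length ≤ T.cmax :=
  Finset.le_sup (f := fun t : Rule Q α β => t.out.length) (ρ.step i hi).1

/-- If the output inside an interval of positions is long, then it is produced in many cells. -/
theorem exists_productive_cells [Fintype Q] (hρ : ρ.Successful) (hn : ρ.Normalized)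
    (x₁ x₂ : ℕ) (K : Set (ℕ × ℕ))
    (hB : T.bound < (outputOf (ρ.restrict (K ∩ Set.Icc x₁ x₂ ×ˢ Set.univ))).length) :
    ∃ S : Finset ℕ, 2 ^ (3 * emax Q) < 2 * S.card + 4 ∧
      ∀ c ∈ S, x₁ < c ∧ c + 1 < x₂ ∧ ∃ t < ρ.len, ρ.hd t = c ∧ ρ.loc t ∈ K ∧ ρ.loc (t + 1) ∈ K ∧
        (ρ.rule t).out ≠ [] := by
  classical
  set l := (List.range ρ.len).filter fun i =>
    ρ.loc i ∈ K ∩ Set.Icc x₁ x₂ ×ˢ Set.univ ∧ ρ.loc (i + 1) ∈ K ∩ Set.Icc x₁ x₂ ×ˢ Set.univ with hl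
  have hr : ρ.restrict (K ∩ Set.Icc x₁ x₂ ×ˢ Set.univ) = l.map ρ.rule := by
    simp only [restrict, hl]
    congr!
  rw [hr] at hB
  set P := (l.filter fun i => (ρ.rule i).out ≠ []).toFinset with hP
  have hmem : ∀ i ∈ P, i < ρ.len ∧ ρ.loc i ∈ K ∧ ρ.loc (i + 1) ∈ K ∧ (ρ.rule i).out ≠ [] ∧
      x₁ ≤ ρ.pos i ∧ ρ.pos i ≤ x₂ := by
    intro i hi
    simp only [hP, hl, List.mem_toFinset, List.mem_filter, List.mem_range, decide_eq_true_eq,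
      Set.mem_inter_iff, Set.mem_prod, Set.mem_Icc, loc] at hi
    simp only [loc]
    tauto
  have hcard : hmax Q * (2 ^ (3 * emax Q) + 4) < P.card := by
    have h1 := ρ.length_output_le T.cmax l fun i hi => output_le_cmax (by
      simp only [hl, List.mem_filter, List.mem_range] at hi
      exact hi.1)
    have hnd : (l.filter fun i => (ρ.rule i).out ≠ []).Nodup :=
      (List.nodup_range.filter _).filter _
    rw [← List.toFinset_card_of_nodup hnd] at h1
    have h2 := hB.trans_le h1
    rw [TwoWayTransducer.bound, mul_assoc] at h2
    exact Nat.lt_of_mul_lt_mul_left h2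
  have hfib : P.card ≤ 2 * Fintype.card Q * (P.image ρ.hd).card := by
    refine Finset.card_le_mul_card_image _ _ fun c _ => ?_
    refine (Finset.card_le_card ?_).trans (hn.card_reading_le hρ c)
    intro i hi
    rw [Finset.mem_filter] at hi
    exact Finset.mem_filter.2 ⟨Finset.mem_range.2 (hmem i hi.1).1, hi.2⟩
  have hQ : 1 ≤ Fintype.card Q := Fintype.card_pos_iff.2 ⟨T.start⟩
  -- Removing these four cells makes both borders of every remaining cell lie strictly between x₁
  -- and x₂.
  refine ⟨P.image ρ.hd \ {x₁ - 1, x₁, x₂ - 1, x₂}, ?_, ?_⟩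
  · have h1 := Finset.le_card_sdiff ({x₁ - 1, x₁, x₂ - 1, x₂} : Finset ℕ) (P.image ρ.hd)
    have h2 := Finset.card_le_four (a := x₁ - 1) (b := x₁) (c := x₂ - 1) (d := x₂)
    have h3 : Fintype.card Q * (2 ^ (3 * emax Q) + 4) <
        Fintype.card Q * (2 * (P.image ρ.hd).card) := by
      calc _ ≤ hmax Q * (2 ^ (3 * emax Q) + 4) := Nat.mul_le_mul_right _ (by unfold hmax; omega)
        _ < P.card := hcard
        _ ≤ _ := hfib
        _ = _ := by ring
    have h4 := Nat.lt_of_mul_lt_mul_left h3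
    omega
  · intro c hc
    rw [Finset.mem_sdiff, Finset.mem_image] at hc
    obtain ⟨⟨t, ht, rfl⟩, hne⟩ := hc
    simp only [Finset.mem_insert, Finset.mem_singleton] at hne
    obtain ⟨h1, h2, h3, h4, h5, h6⟩ := hmem t ht
    have := hρ.pos_eq h1.le
    exact ⟨by omega, by omega, t, h1, rfl, h2, h3, h4⟩

end Run

theorem mainTheorem8 {Q α β : Type*} [Fintype Q] (T : TwoWayTransducer Q α β)
    (hT : T.Functional) (w : List α) (ρ : Run T w) (hρ : ρ.Successful) (hn : ρ.Normalized)
    (x₁ x₂ : ℕ) (hI : ρ.IsInterval x₁ x₂) (l₁ l₂ : ℕ × ℕ) (hK : ρ.Le l₁ l₂)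
    (hB : T.bound <
      (outputOf (ρ.restrict (ρ.locInterval l₁ l₂ ∩ Set.Icc x₁ x₂ ×ˢ Set.univ))).length) :
    ∃ (a b : ℕ) (C : Set ℕ), ρ.IsIdempotentLoop a b ∧ ρ.IsComponent a b C ∧
      x₁ < a ∧ a < b ∧ b < x₂ ∧
      ρ.Lt l₁ (anchor a b C) ∧ ρ.Lt (anchor a b C) l₂ ∧
      ∃ τ, ρ.IsTrace a b C τ ∧ outputOf τ ≠ [] := by
  obtain ⟨S, hSc, hS⟩ := ρ.exists_productive_cells hρ hn x₁ x₂ _ hB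
  have hQ : 1 ≤ Fintype.card Q := Fintype.card_pos_iff.2 ⟨T.start⟩
  have hnum := numeric_bound hQ
  have hSw : ∀ x ∈ S, 0 < x ∧ x ≤ (tape w).length := fun x hx => by
    have h1 := hS x hx
    have h2 := hI.2
    omega
  obtain ⟨U, hUS, hUc, hcr, F, hF⟩ := Run.exists_uniform_positions hρ hn S hSw (by
    unfold emax at hSc
    unfold hmax at hSc ⊢
    omega)
  -- A productive cell c is represented by the cut c on its left, so its transition lies in every
  -- interval that starts at c.
  obtain ⟨V, hVU, hVc⟩ := Finset.exists_subset_card_eq (show 8 ≤ U.card from hUc)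
  set f := V.orderEmbOfFin hVc
  have hf : ∀ k, f k ∈ U := fun k => hVU (V.orderEmbOfFin_mem hVc k)
  have hlt : ∀ j k, j < k → f j < f k := fun j k h => f.strictMono h
  obtain ⟨i₁, i₂, hi12, hi2, rfl, rfl⟩ := hK
  have key : ∀ k₀ k₁ k₂ k₃ : Fin 8, k₀ < k₁ → k₁ < k₂ → k₂ < k₃ →
      ∃ C i, ρ.IsIdempotentLoop (f k₀) (f k₃) ∧ ρ.IsComponent (f k₀) (f k₃) C ∧
        anchor (f k₀) (f k₃) C = ρ.loc i ∧ i < i₂ ∧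
        (i ≤ i₁ → ρ.Inside (f k₀) (f k₃) i₁) ∧
        ∃ τ, ρ.IsTrace (f k₀) (f k₃) C τ ∧ outputOf τ ≠ [] := by
    intro k₀ k₁ k₂ k₃ h01 h12 h23
    obtain ⟨_, _, t, ht, hhd, ht1, ht2, hout⟩ := hS _ (hUS (hf k₁))
    have hi1t : i₁ ≤ t := by
      obtain ⟨⟨i, j, hij, _, hi, hj⟩, _⟩ := ht1
      rw [← ρ.loc_injective' hi, ← ρ.loc_injective' hj]; exact hij
    have hti2 : t < i₂ := by
      obtain ⟨_, ⟨i, j, hij, _, hi, hj⟩⟩ := ht2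
      rw [← ρ.loc_injective' hj]
      have := ρ.loc_injective' hi
      omega
    obtain ⟨C, i, c1, c2, c3, c4, c5, c6⟩ := Run.exists_component_of_middle hρ hn
      (fun x hx => hSw x (hUS hx)) hcr hF (hf k₀) (hf k₁) (hf k₂) (hf k₃) (hlt _ _ h01)
      (hlt _ _ h12) (hlt _ _ h23) ht
      (by rw [Run.inside_iff, hhd]; exact ⟨le_rfl, hlt _ _ h12⟩) hout
    exact ⟨C, i, c1, c2, c3, by omega, fun h => c5 i₁ h hi1t, c6⟩
  have fin : ∀ k₀ k₃ C i, k₀ < k₃ → ρ.IsIdempotentLoop (f k₀) (f k₃) →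
      ρ.IsComponent (f k₀) (f k₃) C → anchor (f k₀) (f k₃) C = ρ.loc i → i < i₂ → i₁ < i →
      (∃ τ, ρ.IsTrace (f k₀) (f k₃) C τ ∧ outputOf τ ≠ []) →
      ∃ (a b : ℕ) (C : Set ℕ), ρ.IsIdempotentLoop a b ∧ ρ.IsComponent a b C ∧
        x₁ < a ∧ a < b ∧ b < x₂ ∧ ρ.Lt (ρ.loc i₁) (anchor a b C) ∧
        ρ.Lt (anchor a b C) (ρ.loc i₂) ∧ ∃ τ, ρ.IsTrace a b C τ ∧ outputOf τ ≠ [] := by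
    intro k₀ k₃ C i h03 c1 c2 c3 c4 c5 c6
    have h1 := hS _ (hUS (hf k₀))
    have h2 := hS _ (hUS (hf k₃))
    refine ⟨_, _, C, c1, c2, h1.1, hlt _ _ h03, by omega, ?_, ?_, c6⟩
    · rw [c3]; exact ⟨i₁, i, c5, by omega, rfl, rfl⟩
    · rw [c3]; exact ⟨i, i₂, c4, hi2, rfl, rfl⟩
  obtain ⟨C, i, c1, c2, c3, c4, c5, c6⟩ := key 0 1 2 3 (by decide) (by decide) (by decide)
  obtain ⟨C', i', d1, d2, d3, d4, d5, d6⟩ := key 4 5 6 7 (by decide) (by decide) (by decide)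
  -- If neither anchor came after ℓ₁, the head at ℓ₁ would be inside both disjoint loops.
  by_cases h : i ≤ i₁
  · by_cases h' : i' ≤ i₁
    · have h1 := c5 h
      have h2 := d5 h'
      rw [Run.inside_iff] at h1 h2
      have := hlt 3 4 (by decide)
      omega
    · exact fin 4 7 C' i' (by decide) d1 d2 d3 d4 (by omega) d6
  · exact fin 0 3 C i (by decide) c1 c2 c3 c4 (by omega) c6
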